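/- **Theorem (squaring map in characteristic 2).** Let $\Bbbk$ be a field of characteristic $2$, let $\mathsf C$ be a small category, and let $\mathcal A$ be a diagram of algebras, i.e. a covariant functor from $\mathsf C$ to the category of associative, not necessarily unital, $\Bbbk$-algebras. *Cochains.* For $p,q\ge 0$ put $$C^{p,q}(\mathcal A,\mathcal A)=\prod_{x_0\leftarrow x_1\leftarrow\dots\leftarrow x_p}\operatorname{Hom}_\Bbbk\bigl(\mathcal A(x_p)^{\otimes q},\mathcal A(x_0)\bigr),$$ the product being over all strings $\phi$ of $p$ composable morphisms of $\mathsf C$. Write $\phi_{i,j}:x_j\to x_i$ ($i\le j$) for the composites. For a string $\phi$ of length $p'$ and a strictly increasing $\zeta:\{0,\dots,p\}\to\{0,\dots,p'\}$, let $\zeta^*\phi$ be the string with objects $x_{\zeta(0)}\leftarrow\dots\leftarrow x_{\zeta(p)}$ (composing morphisms where objects are skipped), and for $f\in C^{p,q}(\mathcal A,\mathcal A)$ let $(\zeta_*f)[\phi]=\mathcal A[\phi_{0,\zeta(0)}]\circ f[\zeta^*\phi]\circ\mathcal A[\phi_{\zeta(p),p'}]^{\otimes q}$. *Coboundary.* Since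 $\operatorname{char}\Bbbk=2$, signs may be omitted. Let $\delta=\delta^{\mathrm S}+\delta^{\mathrm H}$, where $\delta^{\mathrm S}:C^{p,q}\to C^{p+1,q}$ is $\delta^{\mathrm S}f=\sum_{i=0}^{p+1}(\varepsilon_i)_*f$, with $\varepsilon_i$ the strictly increasing map that omits $i$, and $\delta^{\mathrm H}:C^{p,q}\to C^{p,q+1}$ is $$(\delta^{\mathrm H}f)[\phi](a_1,\dots,a_{q+1})=\mathcal A[\phi_{0,p}](a_1)\,f[\phi](a_2,\dots,a_{q+1})+\sum_{i=1}^{q}f[\phi](\dots,a_ia_{i+1},\dots)+f[\phi](a_1,\dots,a_q)\,\mathcal A[\phi_{0,p}](a_{q+1}).$$ The Hochschild cohomology $H^\bullet(\mathcal A,\mathcal A)$ is the cohomology of the total complex $\bigoplus_{p+q=n}C^{p,q}(\mathcal A,\mathcal A)$ with coboundary $\delta$; it is zero in negative degrees. *Composition.* For $f\in C^{p_1,q_1}(\mathcal A,\mathcal A)$ and $g\in C^{p_2,q_2}(\mathcal A,\mathcal A)$ let $f\mathbin{\bar\circ}g=f\circ g+f\bullet g$, where $f\circ g\in C^{p_1+p_2,\,q_1+q_2-1}$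 and $f\bullet g\in C^{p_1+p_2-1,\,q_1+q_2}$ are as follows. - $f\circ g=\sum_{i=1}^{q_1}f\circ_ig$. With $p=p_1+p_2$, the value of $f\circ_ig$ on $\phi=(x_0\leftarrow\dots\leftarrow x_p)$ is obtained from $f[x_0\leftarrow\dots\leftarrow x_{p_1}]$ by inserting $g[x_{p_1}\leftarrow\dots\leftarrow x_p]$ in its $i$-th argument and applying $\mathcal A[\phi_{p_1,p}]$ to its other arguments. - If $p_2=0$, then $f\bullet g=0$. If $p_2\ge1$, put $p=p_1+p_2-1$. For $0\le c<p_1$ let $\eta_c(j)=c+j$ for $0\le j\le p_2$, and let $\xi_c:\{0,\dots,p_1\}\to\{0,\dots,p\}$ be the strictly increasing map with image $\{0,\dots,c\}\cup\{c+p_2,\dots,p\}$. Then $$(f\bullet g)[\phi](a_1,\dots,a_{q_1+q_2})=\sum_{c=0}^{p_1-1}\bigl((\eta_c)_*g\bigr)[\phi](a_1,\dots,a_{q_2})\cdot\bigl((\xi_c)_*f\bigr)[\phi](a_{q_2+1},\dots,a_{q_1+q_2}),$$ the product being taken in $\mathcal A(x_0)$. Extend $\bar\circ$ biadditively to the total complex,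 and let $\operatorname{Sq}(f)=f\mathbin{\bar\circ}f$ for every cochain $f$ in the total complex. *Claim.* For every $k$, if $f$ is a cocycle of total degree $k$, then $\operatorname{Sq}(f)$ is a cocycle of total degree $2k-1$, and $[f]\mapsto[\operatorname{Sq}(f)]$ is a well-defined function $H^k(\mathcal A,\mathcal A)\to H^{2k-1}(\mathcal A,\mathcal A)$. -/

import Mathlib

open CategoryTheory Opposite

universe u v₁ v₂ w

/-- The category of associative, not necessarily unital, algebras over a field `𝕜`. -/
structure NonUnitalAlgCat (𝕜 : Type u) [Field 𝕜] where
  carrier : Type w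
  [ring : NonUnitalRing carrier]
  [module : Module 𝕜 carrier]
  [scalarTower : IsScalarTower 𝕜 carrier carrier]
  [smulComm : SMulCommClass 𝕜 carrier carrier]

namespace NonUnitalAlgCat

variable {𝕜 : Type u} [Field 𝕜]

instance : CoeSort (NonUnitalAlgCat.{u, w} 𝕜) (Type w) := ⟨NonUnitalAlgCat.carrier⟩

instance (A : NonUnitalAlgCat.{u, w} 𝕜) : NonUnitalRing A := A.ring
instance (A : NonUnitalAlgCat.{u, w} 𝕜) : Module 𝕜 A := A.module
instance (A : NonUnitalAlgCat.{u, w} 𝕜) : IsScalarTower 𝕜 A A := A.scalarTower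
instance (A : NonUnitalAlgCat.{u, w} 𝕜) : SMulCommClass 𝕜 A A := A.smulComm

instance : Category (NonUnitalAlgCat.{u, w} 𝕜) where
  Hom A B := A →ₙₐ[𝕜] B
  id A := NonUnitalAlgHom.id 𝕜 A
  comp f g := NonUnitalAlgHom.comp g f

/-- The linear map underlying a morphism of algebras. -/
def linear {A B : NonUnitalAlgCat.{u, w} 𝕜} (f : A ⟶ B) : A →ₗ[𝕜] B :=
  ((show A →ₙₐ[𝕜] B from f) : A →ₗ[𝕜] B)

end NonUnitalAlgCat

namespace DiagramHochschild

section PartialComposition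

variable {U V W : Type w}

/-- The arguments handed to the outer map of a partial composition: the consecutive inputs
`a i, …, a (i + q₂ - 1)` go into `G`, whose value is put in place `i`; every other input is
transported by `t`. -/
def insertArgs {q₁ q₂ q : ℕ} (hq : q₁ + q₂ = q + 1) (i : Fin q₁)
    (G : (Fin q₂ → U) → W) (t : U → W) (a : Fin q → U) : Fin q₁ → W := fun j =>
  if hlt : j.1 < i.1 then t (a ⟨j.1, by omega⟩)
  else if heq : j.1 = i.1 then G (fun l => a ⟨i.1 + l.1, by omega⟩)
  else t (a ⟨j.1 + q₂ - 1, by omega⟩)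

theorem insertArgs_update {q₁ q₂ q : ℕ} (hq : q₁ + q₂ = q + 1) (i : Fin q₁)
    (G : (Fin q₂ → U) → W) (t : U → W) (a : Fin q → U) (m : Fin q) :
    (∃ j : Fin q₁, ∀ x, insertArgs hq i G t (Function.update a m x) =
      Function.update (insertArgs hq i G t a) j (t x)) ∨
    (∃ l : Fin q₂, ∀ x, insertArgs hq i G t (Function.update a m x) =
      Function.update (insertArgs hq i G t a) i
        (G (Function.update (fun l : Fin q₂ => a ⟨i.1 + l.1, by omega⟩) l x))) := by
  rcases lt_or_ge m.1 i.1 with h | h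
  · refine Or.inl ⟨⟨m.1, by omega⟩, fun x => ?_⟩
    funext j
    simp only [insertArgs, Function.update_apply, Fin.ext_iff]
    have : ∀ l : Fin q₂, ¬ (i.1 + l.1 = m.1) := fun l => by omega
    simp only [this, if_false]
    split_ifs <;> first | rfl | omega
  · rcases lt_or_ge m.1 (i.1 + q₂) with h' | h'
    · refine Or.inr ⟨⟨m.1 - i.1, by omega⟩, fun x => ?_⟩
      funext j
      have e : (fun l : Fin q₂ => Function.update a m x ⟨i.1 + l.1, by omega⟩) =
          Function.update (fun l : Fin q₂ => a ⟨i.1 + l.1, by omega⟩) ⟨m.1 - i.1, by omega⟩ x := by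
        funext l
        simp only [Function.update_apply, Fin.ext_iff]
        split_ifs <;> first | rfl | omega
      simp only [insertArgs, e]
      generalize G (Function.update _ _ x) = y
      simp only [insertArgs, Function.update_apply, Fin.ext_iff]
      split_ifs <;> first | rfl | omega
    · refine Or.inl ⟨⟨m.1 + 1 - q₂, by omega⟩, fun x => ?_⟩
      funext j
      simp only [insertArgs, Function.update_apply, Fin.ext_iff]
      have : ∀ l : Fin q₂, ¬ (i.1 + l.1 = m.1) := fun l => by omega
      simp only [this, if_false]
      split_ifs <;> first | rfl | omega

theorem insertArgs_eq_update [Zero W] {q₁ q₂ q : ℕ} (hq : q₁ + q₂ = q + 1) (i : Fin q₁)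
    (G : (Fin q₂ → U) → W) (t : U → W) (a : Fin q → U) :
    insertArgs hq i G t a = Function.update (insertArgs hq i 0 t a) i
      (G (fun l => a ⟨i.1 + l.1, by omega⟩)) := by
  funext j
  simp only [insertArgs, Function.update_apply, Fin.ext_iff]
  split_ifs <;> first | rfl | omega

theorem update_split {q₁ q₂ q : ℕ} (hq : q₁ + q₂ = q) (a : Fin q → U) (m : Fin q) :
    (∃ l : Fin q₂, ∀ x,
      (fun l : Fin q₂ => Function.update a m x ⟨l.1, by omega⟩) =
        Function.update (fun l : Fin q₂ => a ⟨l.1, by omega⟩) l x ∧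
      (fun l : Fin q₁ => Function.update a m x ⟨q₂ + l.1, by omega⟩) =
        fun l : Fin q₁ => a ⟨q₂ + l.1, by omega⟩) ∨
    (∃ l : Fin q₁, ∀ x,
      (fun l : Fin q₂ => Function.update a m x ⟨l.1, by omega⟩) =
        (fun l : Fin q₂ => a ⟨l.1, by omega⟩) ∧
      (fun l : Fin q₁ => Function.update a m x ⟨q₂ + l.1, by omega⟩) =
        Function.update (fun l : Fin q₁ => a ⟨q₂ + l.1, by omega⟩) l x) := by
  rcases lt_or_ge m.1 q₂ with h | h
  · refine Or.inl ⟨⟨m.1, h⟩, fun x => ⟨?_, ?_⟩⟩ <;> funext l <;>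
      simp only [Function.update_apply, Fin.ext_iff] <;> split_ifs <;> first | rfl | omega
  · refine Or.inr ⟨⟨m.1 - q₂, by omega⟩, fun x => ⟨?_, ?_⟩⟩ <;> funext l <;>
      simp only [Function.update_apply, Fin.ext_iff] <;> split_ifs <;> first | rfl | omega

variable {𝕜 : Type u} [Field 𝕜] [AddCommGroup U] [Module 𝕜 U] [AddCommGroup V] [Module 𝕜 V]
  [AddCommGroup W] [Module 𝕜 W]

/-- Partial composition `F ∘ᵢ G`, with the inputs of `F` that are not taken by `G` transported
by the linear map `t`. Places are counted from `0`. -/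
def insertMap {q₁ q₂ q : ℕ} (hq : q₁ + q₂ = q + 1) (i : Fin q₁)
    (F : MultilinearMap 𝕜 (fun _ : Fin q₁ => W) V)
    (G : MultilinearMap 𝕜 (fun _ : Fin q₂ => U) W) (t : U →ₗ[𝕜] W) :
    MultilinearMap 𝕜 (fun _ : Fin q => U) V :=
  MultilinearMap.mk' (fun a => F (insertArgs hq i G t a))
    (by
      intro a m x y
      rcases insertArgs_update hq i G t a m with ⟨j, h⟩ | ⟨l, h⟩ <;> simp [h])
    (by
      intro a m c x
      rcases insertArgs_update hq i G t a m with ⟨j, h⟩ | ⟨l, h⟩ <;> simp [h])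

theorem insertMap_add_left {q₁ q₂ q : ℕ} (hq : q₁ + q₂ = q + 1) (i : Fin q₁)
    (F F' : MultilinearMap 𝕜 (fun _ : Fin q₁ => W) V)
    (G : MultilinearMap 𝕜 (fun _ : Fin q₂ => U) W) (t : U →ₗ[𝕜] W) :
    insertMap hq i (F + F') G t = insertMap hq i F G t + insertMap hq i F' G t := rfl

theorem insertMap_smul_left {q₁ q₂ q : ℕ} (hq : q₁ + q₂ = q + 1) (i : Fin q₁) (c : 𝕜)
    (F : MultilinearMap 𝕜 (fun _ : Fin q₁ => W) V)
    (G : MultilinearMap 𝕜 (fun _ : Fin q₂ => U) W) (t : U →ₗ[𝕜] W) :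
    insertMap hq i (c • F) G t = c • insertMap hq i F G t := rfl

theorem insertMap_add_right {q₁ q₂ q : ℕ} (hq : q₁ + q₂ = q + 1) (i : Fin q₁)
    (F : MultilinearMap 𝕜 (fun _ : Fin q₁ => W) V)
    (G G' : MultilinearMap 𝕜 (fun _ : Fin q₂ => U) W) (t : U →ₗ[𝕜] W) :
    insertMap hq i F (G + G') t = insertMap hq i F G t + insertMap hq i F G' t := by
  ext a
  change F (insertArgs hq i (G + G') t a) =
    F (insertArgs hq i G t a) + F (insertArgs hq i G' t a)
  rw [insertArgs_eq_update hq i _ t a, insertArgs_eq_update hq i G t a,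
    insertArgs_eq_update hq i G' t a, ← F.map_update_add]
  rfl

theorem insertMap_smul_right {q₁ q₂ q : ℕ} (hq : q₁ + q₂ = q + 1) (i : Fin q₁) (c : 𝕜)
    (F : MultilinearMap 𝕜 (fun _ : Fin q₁ => W) V)
    (G : MultilinearMap 𝕜 (fun _ : Fin q₂ => U) W) (t : U →ₗ[𝕜] W) :
    insertMap hq i F (c • G) t = c • insertMap hq i F G t := by
  ext a
  change F (insertArgs hq i (c • G) t a) = c • F (insertArgs hq i G t a)
  rw [insertArgs_eq_update hq i _ t a, insertArgs_eq_update hq i G t a, ← F.map_update_smul]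
  rfl

theorem compLinear_add {q : ℕ} (F G : MultilinearMap 𝕜 (fun _ : Fin q => W) V) (t : U →ₗ[𝕜] W) :
    (F + G).compLinearMap (fun _ => t) =
      F.compLinearMap (fun _ => t) + G.compLinearMap fun _ => t := rfl

theorem compLinear_smul {q : ℕ} (c : 𝕜) (F : MultilinearMap 𝕜 (fun _ : Fin q => W) V)
    (t : U →ₗ[𝕜] W) :
    (c • F).compLinearMap (fun _ => t) = c • F.compLinearMap fun _ => t := rfl

end PartialComposition

section Product

variable {𝕜 : Type u} [Field 𝕜] {A : NonUnitalAlgCat.{u, w} 𝕜} {U : Type w}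
  [AddCommGroup U] [Module 𝕜 U]

/-- The product `(a₁, …, a_q) ↦ G(a₁, …, a_{q₂}) F(a_{q₂+1}, …, a_q)` of two multilinear maps
with values in an algebra. -/
def mulMap {q₁ q₂ q : ℕ} (hq : q₁ + q₂ = q) (G : MultilinearMap 𝕜 (fun _ : Fin q₂ => U) A)
    (F : MultilinearMap 𝕜 (fun _ : Fin q₁ => U) A) : MultilinearMap 𝕜 (fun _ : Fin q => U) A :=
  MultilinearMap.mk'
    (fun a => G (fun l => a ⟨l.1, by omega⟩) * F (fun l => a ⟨q₂ + l.1, by omega⟩))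
    (by
      intro a m x y
      rcases update_split hq a m with ⟨l, h⟩ | ⟨l, h⟩ <;>
        simp only [(h _).1, (h _).2, MultilinearMap.map_update_add, add_mul, mul_add])
    (by
      intro a m c x
      rcases update_split hq a m with ⟨l, h⟩ | ⟨l, h⟩ <;>
        simp only [(h _).1, (h _).2, MultilinearMap.map_update_smul, smul_mul_assoc,
          mul_smul_comm])

end Product

section Cochains

variable {𝕜 : Type u} [Field 𝕜] {C : Type v₁} [Category.{v₂} C]

/-- The `p`-simplices `x₀ ← x₁ ← ⋯ ← x_p` of the nerve of `C`. -/
abbrev Nerve (C : Type v₁) [Category.{v₂} C] (p : ℕ) := (Fin (p + 1))ᵒᵖ ⥤ C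

namespace Nerve

/-- The action `ζ^*` of a map `ζ : [p] → [p']` on simplices. -/
def pull {p p' : ℕ} (ζ : Fin (p + 1) →o Fin (p' + 1)) (φ : Nerve C p') : Nerve C p :=
  ζ.monotone.functor.op ⋙ φ

/-- The `i`-th object `x_i`. -/
abbrev vertex {p : ℕ} (φ : Nerve C p) (i : Fin (p + 1)) : C := φ.obj (op i)

/-- The composite morphism `φ_{i,j} : x_j ⟶ x_i`, for `i ≤ j`. -/
def edge {p : ℕ} (φ : Nerve C p) {i j : Fin (p + 1)} (h : i ≤ j) : φ.vertex j ⟶ φ.vertex i :=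
  φ.map (homOfLE h).op

end Nerve

variable (𝒜 : C ⥤ NonUnitalAlgCat.{u, w} 𝕜)

/-- The linear map `𝒜[φ_{i,j}] : 𝒜(x_j) → 𝒜(x_i)`, for `i ≤ j`. -/
def transport {p : ℕ} (φ : Nerve C p) {i j : Fin (p + 1)} (h : i ≤ j) :
    𝒜.obj (φ.vertex j) →ₗ[𝕜] 𝒜.obj (φ.vertex i) :=
  NonUnitalAlgCat.linear (𝒜.map (φ.edge h))

/-- `C^{p,q}(𝒜, 𝒜)`: a `q`-linear map `𝒜(x_p)^q → 𝒜(x₀)` for each `x₀ ← ⋯ ← x_p`. -/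
abbrev Cochain (p q : ℕ) :=
  ∀ φ : Nerve C p, MultilinearMap 𝕜 (fun _ : Fin q => 𝒜.obj (φ.vertex (Fin.last p)))
    (𝒜.obj (φ.vertex 0))

variable {𝒜}

/-- The value `f[ζ^*φ] : 𝒜(x_{ζ(p)})^q → 𝒜(x_{ζ(0)})`. -/
def evalAt {p p' q : ℕ} (ζ : Fin (p + 1) →o Fin (p' + 1)) (f : Cochain 𝒜 p q) (φ : Nerve C p') :
    MultilinearMap 𝕜 (fun _ : Fin q => 𝒜.obj (φ.vertex (ζ (Fin.last p))))
      (𝒜.obj (φ.vertex (ζ 0))) :=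
  f (φ.pull ζ)

theorem evalAt_add {p p' q : ℕ} (ζ : Fin (p + 1) →o Fin (p' + 1)) (f g : Cochain 𝒜 p q)
    (φ : Nerve C p') : evalAt ζ (f + g) φ = evalAt ζ f φ + evalAt ζ g φ := rfl

theorem evalAt_smul {p p' q : ℕ} (ζ : Fin (p + 1) →o Fin (p' + 1)) (c : 𝕜) (f : Cochain 𝒜 p q)
    (φ : Nerve C p') : evalAt ζ (c • f) φ = c • evalAt ζ f φ := rfl

/-- The action of a strictly increasing map `ζ : [p] → [p']` on cochains:
`𝒜[φ_{0,ζ(0)}] ∘ f[ζ^*φ] ∘ 𝒜[φ_{ζ(p),p'}]^{⊗q}`. -/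
def act {p p' q : ℕ} (ζ : Fin (p + 1) →o Fin (p' + 1)) (f : Cochain 𝒜 p q) : Cochain 𝒜 p' q :=
  fun φ => (transport 𝒜 φ (Fin.zero_le (ζ 0))).compMultilinearMap
    ((evalAt ζ f φ).compLinearMap fun _ =>
      transport 𝒜 φ (Fin.le_last (ζ (Fin.last p))))

/-- The simplicial coboundary `δ^S = ∑ᵢ (-1)^i δ^S_i`, where `δ^S_i` is the action of the `i`-th
face map. -/
def deltaS {p q : ℕ} (f : Cochain 𝒜 p q) : Cochain 𝒜 (p + 1) q :=
  ∑ i : Fin (p + 2), (-1 : 𝕜) ^ i.1 • act (Fin.succAboveOrderEmb i).toOrderHom f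

/-- The inclusion `j ↦ j` of `[p₁]` in `[p]`. -/
def front {p₁ p₂ p : ℕ} (hp : p₁ + p₂ = p) : Fin (p₁ + 1) →o Fin (p + 1) where
  toFun j := ⟨j.1, by omega⟩
  monotone' _ _ h := h

/-- The inclusion `j ↦ p₁ + j` of `[p₂]` in `[p]`. -/
def back {p₁ p₂ p : ℕ} (hp : p₁ + p₂ = p) : Fin (p₂ + 1) →o Fin (p + 1) where
  toFun j := ⟨p₁ + j.1, by omega⟩
  monotone' _ _ h := Nat.add_le_add_left h p₁

/-- The inclusion `j ↦ c + j` of `[p₂]` in `[p]`, for `c < p₁`. -/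
def inner {p₁ p₂ p : ℕ} (hp : p₁ + p₂ = p + 1) (c : Fin p₁) : Fin (p₂ + 1) →o Fin (p + 1) where
  toFun j := ⟨c.1 + j.1, by omega⟩
  monotone' _ _ h := Nat.add_le_add_left h c.1

/-- The increasing map `[p₁] → [p]` with image `{0, …, c} ∪ {c + p₂, …, p}`, for `c < p₁` and
`1 ≤ p₂`. -/
def outer {p₁ p₂ p : ℕ} (hp : p₁ + p₂ = p + 1) (c : Fin p₁) (h₂ : 1 ≤ p₂) :
    Fin (p₁ + 1) →o Fin (p + 1) where
  toFun j := if j.1 ≤ c.1 then ⟨j.1, by omega⟩ else ⟨j.1 + p₂ - 1, by omega⟩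
  monotone' i j h := by
    have h' : i.1 ≤ j.1 := h
    dsimp only
    split_ifs <;> simp only [Fin.mk_le_mk] <;> omega

/-- The operation `f ∘ g` on cochains of bidegrees `(p₁, q₁)` and `(p₂, q₂)`: with `p = p₁ + p₂`,
it inserts `g` on `x_{p₁} ← ⋯ ← x_p` in each of the arguments of `f` on `x₀ ← ⋯ ← x_{p₁}`. -/
def circ {p₁ q₁ p₂ q₂ p q : ℕ} (hp : p₁ + p₂ = p) (hq : q₁ + q₂ = q + 1)
    (f : Cochain 𝒜 p₁ q₁) (g : Cochain 𝒜 p₂ q₂) : Cochain 𝒜 p q := fun φ =>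
  ∑ i : Fin q₁, (-1 : 𝕜) ^ (p₂ * (q₁ + 1) + (q₁ + i.1 + 1) * (q₂ + 1)) •
    (transport 𝒜 φ (Fin.zero_le (front hp 0))).compMultilinearMap
      (insertMap hq i (evalAt (front hp) f φ)
        ((transport 𝒜 φ (show front hp (Fin.last p₁) ≤ back hp 0 from
            Nat.le_refl p₁)).compMultilinearMap
          ((evalAt (back hp) g φ).compLinearMap fun _ =>
            transport 𝒜 φ (Fin.le_last (back hp (Fin.last p₂)))))
        (transport 𝒜 φ (Fin.le_last (front hp (Fin.last p₁)))))

/-- The operation `f • g` on cochains of bidegrees `(p₁, q₁)` and `(p₂, q₂)`: with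
`p = p₁ + p₂ - 1`, it is the signed sum over `0 ≤ c < p₁` of the products of `g` on
`x_c ← ⋯ ← x_{c + p₂}` with `f` on `x₀ ← ⋯ ← x_c ← x_{c + p₂} ← ⋯ ← x_p`, where `g` takes the
first `q₂` arguments and `f` the remaining `q₁`. It is `0` if `p₂ = 0`, as `x₀ ← ⋯ ← x_p` then
has too few vertices for a strictly increasing map from `[p₁]`. -/
def bullet {p₁ q₁ p₂ q₂ p q : ℕ} (hp : p₁ + p₂ = p + 1) (hq : q₁ + q₂ = q)
    (f : Cochain 𝒜 p₁ q₁) (g : Cochain 𝒜 p₂ q₂) : Cochain 𝒜 p q := fun φ =>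
  if h₂ : 1 ≤ p₂ then
    ∑ c : Fin p₁, (-1 : 𝕜) ^ (q₁ * (p₂ + q₂ + 1) + (p₂ + 1) * (p₁ + c.1 + 1)) •
      mulMap hq (act (inner hp c) g φ) (act (outer hp c h₂) f φ)
  else 0

variable (𝒜)

/-- Multiplication as a cochain `m̂` of bidegree `(0, 2)`. -/
def mulCochain : Cochain 𝒜 0 2 := fun φ =>
  (transport 𝒜 φ (Fin.zero_le (Fin.last 0))).compMultilinearMap
    (mulMap (q₁ := 1) (q₂ := 1) rfl
      (MultilinearMap.ofSubsingleton 𝕜 _ _ 0 LinearMap.id)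
      (MultilinearMap.ofSubsingleton 𝕜 _ _ 0 LinearMap.id))

variable {𝒜}

/-- The Hochschild coboundary `δ^H f = m̂ ∘ f - (-1)^{|f|} f ∘ m̂`, where `|f| = p + q - 1`. -/
def deltaH {p q : ℕ} (f : Cochain 𝒜 p q) : Cochain 𝒜 p (q + 1) :=
  circ (Nat.zero_add p) (by omega) (mulCochain 𝒜) f -
    (-1 : 𝕜) ^ (p + q + 1) • circ (Nat.add_zero p) (by omega) f (mulCochain 𝒜)

theorem act_add {p p' q : ℕ} (ζ : Fin (p + 1) →o Fin (p' + 1)) (f g : Cochain 𝒜 p q) :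
    act ζ (f + g) = act ζ f + act ζ g := by
  funext φ
  ext a
  simp [act, evalAt_add]

theorem act_smul {p p' q : ℕ} (ζ : Fin (p + 1) →o Fin (p' + 1)) (c : 𝕜) (f : Cochain 𝒜 p q) :
    act ζ (c • f) = c • act ζ f := by
  funext φ
  ext a
  simp [act, evalAt_smul]

theorem deltaS_add {p q : ℕ} (f g : Cochain 𝒜 p q) : deltaS (f + g) = deltaS f + deltaS g := by
  simp only [deltaS, act_add, smul_add, Finset.sum_add_distrib]

theorem deltaS_smul {p q : ℕ} (c : 𝕜) (f : Cochain 𝒜 p q) : deltaS (c • f) = c • deltaS f := by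
  simp only [deltaS, act_smul, Finset.smul_sum, smul_comm c]

theorem circ_add_left {p₁ q₁ p₂ q₂ p q : ℕ} (hp : p₁ + p₂ = p) (hq : q₁ + q₂ = q + 1)
    (f f' : Cochain 𝒜 p₁ q₁) (g : Cochain 𝒜 p₂ q₂) :
    circ hp hq (f + f') g = circ hp hq f g + circ hp hq f' g := by
  funext φ
  ext a
  simp [circ, evalAt_add, insertMap_add_left, Finset.sum_add_distrib]

theorem circ_smul_left {p₁ q₁ p₂ q₂ p q : ℕ} (hp : p₁ + p₂ = p) (hq : q₁ + q₂ = q + 1)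
    (c : 𝕜) (f : Cochain 𝒜 p₁ q₁) (g : Cochain 𝒜 p₂ q₂) :
    circ hp hq (c • f) g = c • circ hp hq f g := by
  funext φ
  ext a
  simp [circ, evalAt_smul, insertMap_smul_left, Finset.smul_sum, smul_comm c]

theorem circ_add_right {p₁ q₁ p₂ q₂ p q : ℕ} (hp : p₁ + p₂ = p) (hq : q₁ + q₂ = q + 1)
    (f : Cochain 𝒜 p₁ q₁) (g g' : Cochain 𝒜 p₂ q₂) :
    circ hp hq f (g + g') = circ hp hq f g + circ hp hq f g' := by
  funext φ
  ext a
  simp [circ, evalAt_add, compLinear_add, LinearMap.compMultilinearMap_add, insertMap_add_right,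
    Finset.sum_add_distrib]

theorem circ_smul_right {p₁ q₁ p₂ q₂ p q : ℕ} (hp : p₁ + p₂ = p) (hq : q₁ + q₂ = q + 1)
    (c : 𝕜) (f : Cochain 𝒜 p₁ q₁) (g : Cochain 𝒜 p₂ q₂) :
    circ hp hq f (c • g) = c • circ hp hq f g := by
  funext φ
  ext a
  simp [circ, evalAt_smul, compLinear_smul, LinearMap.compMultilinearMap_smul, insertMap_smul_right,
    Finset.smul_sum, smul_comm c]

theorem deltaH_add {p q : ℕ} (f g : Cochain 𝒜 p q) : deltaH (f + g) = deltaH f + deltaH g := by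
  simp only [deltaH, circ_add_left, circ_add_right, smul_add]
  abel

theorem deltaH_smul {p q : ℕ} (c : 𝕜) (f : Cochain 𝒜 p q) : deltaH (c • f) = c • deltaH f := by
  simp only [deltaH, circ_smul_left, circ_smul_right, smul_sub, smul_comm c]

end Cochains

section Cohomology

variable {𝕜 : Type u} [Field 𝕜] {C : Type v₁} [Category.{v₂} C]
  (𝒜 : C ⥤ NonUnitalAlgCat.{u, w} 𝕜)

/-- Families of cochains, one in each bidegree `(p, q)`. -/
abbrev BiCochain := ∀ p q : ℕ, Cochain 𝒜 p q

/-- The part of total degree `n`: the families concentrated in the bidegrees with `p + q = n`,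
that is, `⨁_{p+q=n} C^{p,q}(𝒜, 𝒜)`. It is zero for `n < 0`. -/
def tot (n : ℤ) : Submodule 𝕜 (BiCochain 𝒜) where
  carrier := {f | ∀ p q : ℕ, (p : ℤ) + q ≠ n → f p q = 0}
  add_mem' hf hg p q h := by simp [hf p q h, hg p q h]
  zero_mem' _ _ _ := rfl
  smul_mem' c f hf p q h := by simp [hf p q h]

/-- The total coboundary `δ = δ^S + δ^H`. -/
def delta : BiCochain 𝒜 →ₗ[𝕜] BiCochain 𝒜 where
  toFun f p q :=
    (match p with
      | 0 => 0
      | p + 1 => deltaS (f p q)) +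
    (match q with
      | 0 => 0
      | q + 1 => deltaH (f p q))
  map_add' f g := by
    funext p q
    rcases p with _ | p <;> rcases q with _ | q <;>
      simp only [Pi.add_apply, deltaS_add, deltaH_add] <;> abel
  map_smul' c f := by
    funext p q
    rcases p with _ | p <;> rcases q with _ | q <;>
      simp only [Pi.smul_apply, deltaS_smul, deltaH_smul, RingHom.id_apply, smul_add, smul_zero]

/-- The cocycles of total degree `n`. -/
def cocycles (n : ℤ) : Submodule 𝕜 (BiCochain 𝒜) := tot 𝒜 n ⊓ LinearMap.ker (delta 𝒜)

/-- The coboundaries of total degree `n`. -/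
def coboundaries (n : ℤ) : Submodule 𝕜 (BiCochain 𝒜) := (tot 𝒜 (n - 1)).map (delta 𝒜)

/-- The Hochschild cohomology `H^n(𝒜, 𝒜)`. -/
abbrev HochschildCohomology (n : ℤ) :=
  cocycles 𝒜 n ⧸ (coboundaries 𝒜 n).submoduleOf (cocycles 𝒜 n)

variable {𝒜}

/-- The cohomology class of a cocycle. -/
def cohomologyClass {n : ℤ} (f : BiCochain 𝒜) (hf : f ∈ cocycles 𝒜 n) :
    HochschildCohomology 𝒜 n :=
  Submodule.Quotient.mk ⟨f, hf⟩

open Finset.HasAntidiagonal in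
/-- The composition operation `f ∘̄ g = f ∘ g + f • g`, extended to families by additivity. -/
def compBar (f g : BiCochain 𝒜) : BiCochain 𝒜 := fun p q =>
  (∑ x : antidiagonal p, ∑ y : antidiagonal (q + 1),
    circ (mem_antidiagonal.mp x.2) (mem_antidiagonal.mp y.2)
      (f x.1.1 y.1.1) (g x.1.2 y.1.2)) +
  ∑ x : antidiagonal (p + 1), ∑ y : antidiagonal q,
    bullet (mem_antidiagonal.mp x.2) (mem_antidiagonal.mp y.2)
      (f x.1.1 y.1.1) (g x.1.2 y.1.2)

/-- The squaring map `Sq(f) = f ∘̄ f`. -/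
def Sq (f : BiCochain 𝒜) : BiCochain 𝒜 := compBar f f

end Cohomology

end DiagramHochschild

/-!
In characteristic 2 the composition `f ∘̄ g = f ∘ g + f • g` satisfies
`δ(f ∘̄ g) = δf ∘̄ g + f ∘̄ δg + f ⌣ g + g ⌣ f`, where `⌣` is the cup product (`delta_compBar`),
and `δ` is a derivation of `⌣` (`delta_cup`). Hence `δ(Sq f) = f ⌣ f + f ⌣ f = 0` for a cocycle
`f`, and if `f = f' + δh` with cocycles `f` and `f'`, then `Sq f - Sq f'` is the coboundary of
`f' ∘̄ h + h ∘̄ f' + h ∘̄ δh + h ⌣ h`. Here `δδh = 0` because `f` and `f'` are cocycles, so that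
`δ² = 0` is never needed.

The two parts of the composition have complementary defects. The Hochschild part of `δ` fails to
be a derivation of `f ∘ g`, as in Gerstenhaber's work, by the products in which `g` sits in an
outer place of a multiplication. One of these is `f ⌣ g`; the other is the product of `g` on
`x_m ← ⋯ ← x_p`, transported to `x₀`, with `f` on `x₀ ← ⋯ ← x_m`, which is not `g ⌣ f`. The
operation `f • g` is a version of Steenrod's cup-1 product: the simplicial part of `δ` fails to be
a derivation of it by `g ⌣ f` and the same product of the transported `g` with `f`, which
therefore cancels.

To separate the two directions, a family `F` of cochains is evaluated, for a fixed simplex `φ`, on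
a set `S` of vertices and on a word of elements (`faceVal`). In these terms the simplicial
coboundary is a sum over the vertices removed from `S`, and the Hochschild coboundary is an
operation on functions on words (`wordDelta`), so that `faceVal_delta` reads
`(δF)(S) = ∑ x ∈ S, F(S \ {x}) + wordDelta (F(S))`. The operation `∘` and the cup product are sums
over a vertex at which the simplex is cut, and `•` is a sum over pairs of vertices `c < d`. The
Leibniz rules on words are `wordDelta_cup` and `wordDelta_insertSum`; those over the vertices of a
simplex are `sum_erase_cut` and `sum_erase_interval`.
-/

namespace DiagramHochschild

/-! ### Hochschild calculus on words -/

section Words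

variable {B B' M : Type*}

/-- The sum of `Φ u v` over all factorizations `l = u ++ v` of a word. -/
def splitSum [AddCommMonoid M] : (List B → List B → M) → List B → M
  | Φ, [] => Φ [] []
  | Φ, x :: l => Φ [] (x :: l) + splitSum (fun u v => Φ (x :: u) v) l

/-- The sum of the values of `F` on the words obtained by multiplying two adjacent letters. -/
def mergeSum [Mul B] [AddCommMonoid M] : (List B → M) → List B → M
  | _, [] => 0
  | _, [_] => 0
  | F, x :: y :: l => F (x * y :: l) + mergeSum (fun z => F (x :: z)) (y :: l)

/-- The value `c` on the empty word, and `0` on every other word. -/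
def atNil [Zero M] (c : M) : List B → M
  | [] => c
  | _ :: _ => 0

/-- The function `x l ↦ τ(x) F(l)` on nonempty words, with value `0` on the empty word. -/
def leadTerm [Mul M] [Zero M] (τ : B → M) (F : List B → M) : List B → M
  | [] => 0
  | x :: l => τ x * F l

/-- The function `l x ↦ F(l) τ(x)` on nonempty words, with value `0` on the empty word. -/
def trailTerm [NonUnitalNonAssocSemiring M] (τ : B → M) : (List B → M) → List B → M
  | _, [] => 0
  | F, x :: l => atNil (F [] * τ x) l + trailTerm τ (fun z => F (x :: z)) l

/-- The Hochschild coboundary, without signs, of a function on words with values in an algebra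
on which the letters act through `τ`. -/
def wordDelta [Mul B] [NonUnitalNonAssocSemiring M] (τ : B → M) (F : List B → M)
    (l : List B) : M :=
  leadTerm τ F l + mergeSum F l + trailTerm τ F l

/-- The sum of `F(t(v) g(w₁) t(w₂))` over all factorizations `l = v w₁ w₂` of a word. -/
def insertSum [AddCommMonoid M] (t : B → B') (g : List B → B') (F : List B' → M)
    (l : List B) : M :=
  splitSum (fun v r => splitSum (fun w₁ w₂ => F (v.map t ++ g w₁ :: w₂.map t)) r) l

/-- The sum of `F(g(w₁) t(w₂))` over all factorizations `l = w₁ w₂` of a word. -/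
def headInsertSum [AddCommMonoid M] (t : B → B') (g : List B → B') (F : List B' → M)
    (l : List B) : M :=
  splitSum (fun w₁ w₂ => F (g w₁ :: w₂.map t)) l

/-- The function `y l ↦ F((x y) l)` on nonempty words, with value `0` on the empty word. -/
def scaleHead [Mul B] [Zero M] (x : B) (F : List B → M) : List B → M
  | [] => 0
  | y :: z => F (x * y :: z)

/-- Additivity of a function on words in each letter. -/
def LetterAdditive [Add B] [Add M] (F : List B → M) : Prop :=
  ∀ u a b w, F (u ++ (a + b) :: w) = F (u ++ a :: w) + F (u ++ b :: w)

section Additive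

variable [AddCommMonoid M]

theorem splitSum_add (Φ Ψ : List B → List B → M) (l : List B) :
    splitSum (fun u v => Φ u v + Ψ u v) l = splitSum Φ l + splitSum Ψ l := by
  induction l generalizing Φ Ψ with
  | nil => rfl
  | cons x l ih => simp only [splitSum, ih]; abel

theorem splitSum_zero (l : List B) : splitSum (fun _ _ => (0 : M)) l = 0 := by
  induction l with
  | nil => rfl
  | cons x l ih => simp [splitSum, ih]

theorem map_splitSum {M' : Type*} [AddCommMonoid M'] (T : M →+ M') (Φ : List B → List B → M)
    (l : List B) : T (splitSum Φ l) = splitSum (fun u v => T (Φ u v)) l := by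
  induction l generalizing Φ with
  | nil => rfl
  | cons x l ih => simp [splitSum, ih]

theorem splitSum_eq_sum (Φ : List B → List B → M) (l : List B) :
    splitSum Φ l = ∑ i ∈ Finset.range (l.length + 1), Φ (l.take i) (l.drop i) := by
  induction l generalizing Φ with
  | nil => simp [splitSum]
  | cons x l ih =>
    rw [splitSum, ih, List.length_cons, Finset.sum_range_succ' _ (l.length + 1), add_comm]
    simp

theorem splitSum_atNil_right (c : List B → M) (l : List B) :
    splitSum (fun u v => atNil (c u) v) l = c l := by
  induction l generalizing c with
  | nil => rfl
  | cons x l ih => simpa [splitSum, atNil] using ih fun u => c (x :: u)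

theorem mergeSum_add [Mul B] (F G : List B → M) (l : List B) :
    mergeSum (fun z => F z + G z) l = mergeSum F l + mergeSum G l := by
  induction l generalizing F G with
  | nil => simp [mergeSum]
  | cons x l ih =>
    cases l with
    | nil => simp [mergeSum]
    | cons y l => simp only [mergeSum, ih]; abel

theorem map_mergeSum [Mul B] {M' : Type*} [AddCommMonoid M'] (T : M →+ M') (F : List B → M)
    (l : List B) : T (mergeSum F l) = mergeSum (fun z => T (F z)) l := by
  induction l generalizing F with
  | nil => simp [mergeSum]
  | cons x l ih =>
    cases l with
    | nil => simp [mergeSum]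
    | cons y l => simp [mergeSum, ih]

theorem mergeSum_map [Mul B] [Mul B'] (t : B → B') (ht : ∀ x y, t (x * y) = t x * t y)
    (F : List B' → M) (l : List B) : mergeSum F (l.map t) = mergeSum (fun z => F (z.map t)) l := by
  induction l generalizing F with
  | nil => simp [mergeSum]
  | cons x l ih =>
    cases l with
    | nil => simp [mergeSum]
    | cons y l =>
      have := ih (fun z => F (t x :: z))
      simp only [List.map_cons] at this
      simp [mergeSum, this, ht]

theorem mergeSum_eq_sum [Mul B] (F : List B → M) (l : List B) :
    mergeSum F l = ∑ i : Fin (l.length - 1),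
      F (l.take i ++ (l[i.1]'(by omega) * l[i.1 + 1]'(by omega)) :: l.drop (i + 2)) := by
  induction l generalizing F with
  | nil => simp [mergeSum]
  | cons x l ih =>
    cases l with
    | nil => simp [mergeSum]
    | cons y l =>
      rw [mergeSum, ih]
      exact (Fin.sum_univ_succ (n := l.length) (fun i : Fin (l.length + 1) =>
        F ((x :: y :: l).take i ++ ((x :: y :: l)[i.1]'(by have := i.2; simp) *
          (x :: y :: l)[i.1 + 1]'(by simp; omega)) :: (x :: y :: l).drop (i + 2)))).symm

/-- A product of two adjacent letters falls into one of the two factors of a factorization. -/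
theorem mergeSum_splitSum [Mul B] (Φ : List B → List B → M) (l : List B) :
    mergeSum (splitSum Φ) l =
      splitSum (fun u v => mergeSum (fun z => Φ z v) u + mergeSum (Φ u) v) l := by
  induction l generalizing Φ with
  | nil => simp [mergeSum, splitSum]
  | cons x l ih =>
    cases l with
    | nil => simp [mergeSum, splitSum]
    | cons y l =>
      simp only [mergeSum, mergeSum_add, ih, splitSum, splitSum_add]
      abel

theorem insertSum_nil (t : B → B') (g : List B → B') (F : List B' → M) :
    insertSum t g F [] = F [g []] := rfl

theorem insertSum_cons (t : B → B') (g : List B → B') (F : List B' → M) (x : B) (l : List B) :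
    insertSum t g F (x :: l) =
      headInsertSum t g F (x :: l) + insertSum t g (fun z => F (t x :: z)) l := rfl

theorem insertSum_add (t : B → B') (g : List B → B') (F G : List B' → M) (l : List B) :
    insertSum t g (fun z => F z + G z) l = insertSum t g F l + insertSum t g G l := by
  simp only [insertSum, splitSum_add]

theorem insertSum_congr (t : B → B') (g : List B → B') {F G : List B' → M}
    (h : ∀ x z, F (x :: z) = G (x :: z)) (l : List B) :
    insertSum t g F l = insertSum t g G l := by
  unfold insertSum
  congr 1; funext u r; congr 1; funext v w
  cases u <;> simp [h]

end Additive

theorem LetterAdditive.zero [AddMonoid B] [AddGroup M] {F : List B → M} (hF : LetterAdditive F)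
    (u w : List B) : F (u ++ 0 :: w) = 0 := by
  simpa using hF u 0 0 w

theorem LetterAdditive.cons [Add B] [Add M] {F : List B → M} (hF : LetterAdditive F) (x : B) :
    LetterAdditive (fun z => F (x :: z)) := fun u a b w => hF (x :: u) a b w

/-- A letter-additive function as an additive function of its first letter. -/
def LetterAdditive.headHom [AddMonoid B] [AddCommGroup M] {F : List B → M}
    (hF : LetterAdditive F) (w : List B) : B →+ M where
  toFun a := F (a :: w)
  map_zero' := hF.zero [] w
  map_add' a b := hF [] a b w

theorem insertSum_add_inner [Add B'] [AddCommMonoid M] (t : B → B')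
    (g g' : List B → B') {F : List B' → M}
    (hF : LetterAdditive F) (l : List B) :
    insertSum t (fun z => g z + g' z) F l = insertSum t g F l + insertSum t g' F l := by
  simp only [insertSum, hF _ _ _ _, splitSum_add]

section Ring

variable [NonUnitalRing M]

theorem leadTerm_add (τ : B → M) (F G : List B → M) (l : List B) :
    leadTerm τ (fun z => F z + G z) l = leadTerm τ F l + leadTerm τ G l := by
  cases l <;> simp [leadTerm, mul_add]

theorem atNil_add (a b : M) (l : List B) : atNil (a + b) l = atNil a l + atNil b l := by
  cases l <;> simp [atNil]

theorem trailTerm_add (τ : B → M) (F G : List B → M) (l : List B) :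
    trailTerm τ (fun z => F z + G z) l = trailTerm τ F l + trailTerm τ G l := by
  induction l generalizing F G with
  | nil => simp [trailTerm]
  | cons x l ih => simp only [trailTerm, ih, add_mul, atNil_add]; abel

theorem wordDelta_add [Mul B] (τ : B → M) (F G : List B → M) (l : List B) :
    wordDelta τ (fun z => F z + G z) l = wordDelta τ F l + wordDelta τ G l := by
  simp only [wordDelta, leadTerm_add, mergeSum_add, trailTerm_add]; abel

theorem wordDelta_zero [Mul B] (τ : B → M) (l : List B) :
    wordDelta τ (fun _ => (0 : M)) l = 0 := by
  simpa using wordDelta_add τ (fun _ => (0 : M)) (fun _ => 0) l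

theorem wordDelta_sum [Mul B] {ι : Type*} (s : Finset ι) (τ : B → M) (F : ι → List B → M)
    (l : List B) :
    wordDelta τ (fun z => ∑ i ∈ s, F i z) l = ∑ i ∈ s, wordDelta τ (F i) l := by
  classical
  induction s using Finset.induction_on with
  | empty => simp [wordDelta_zero]
  | insert i s hi ih => simp [Finset.sum_insert hi, wordDelta_add, ih]

theorem map_trailTerm {M' : Type*} [NonUnitalRing M'] (T : M →+ M') (τ : B → M) (τ' : B → M')
    (hT : ∀ x b, T (x * τ b) = T x * τ' b) (F : List B → M) (l : List B) :
    T (trailTerm τ F l) = trailTerm τ' (fun z => T (F z)) l := by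
  induction l generalizing F with
  | nil => simp [trailTerm]
  | cons x l ih =>
    have : T (atNil (F [] * τ x) l) = atNil (T (F []) * τ' x) l := by
      cases l <;> simp [atNil, hT]
    simp [trailTerm, ih, this]

theorem trailTerm_map (t : B → B') (τ : B' → M) (F : List B' → M) (l : List B) :
    trailTerm τ F (l.map t) = trailTerm (fun b => τ (t b)) (fun z => F (z.map t)) l := by
  induction l generalizing F with
  | nil => simp [trailTerm]
  | cons x l ih =>
    have : ∀ c : M, atNil c (l.map t) = atNil c l := fun c => by cases l <;> rfl
    simp [trailTerm, ih, this]

/-- Naturality of the Hochschild coboundary in the coefficients and in the letters. -/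
theorem map_wordDelta [Mul B] [Mul B'] {M' : Type*} [NonUnitalRing M'] (T : M →+ M')
    (hT : ∀ x y, T (x * y) = T x * T y) (t : B → B') (ht : ∀ x y, t (x * y) = t x * t y)
    (τ : B' → M) (F : List B' → M) (l : List B) :
    T (wordDelta τ F (l.map t)) =
      wordDelta (fun b => T (τ (t b))) (fun z => T (F (z.map t))) l := by
  simp only [wordDelta, map_add, mergeSum_map t ht, trailTerm_map, map_mergeSum]
  rw [map_trailTerm T (fun b => τ (t b)) (fun b => T (τ (t b))) (fun _ _ => hT _ _)]
  congr 2
  cases l <;> simp [leadTerm, hT]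

theorem trailTerm_splitSum (τ : B → M) (Φ : List B → List B → M) (l : List B) :
    trailTerm τ (splitSum Φ) l = splitSum (fun u v => trailTerm τ (Φ u) v) l := by
  induction l generalizing Φ with
  | nil => simp [trailTerm, splitSum]
  | cons x l ih =>
    simp only [trailTerm, splitSum, trailTerm_add, ih, add_assoc]

/-- Moving the letter at a cut from the end of the first factor to the start of the second. -/
theorem splitSum_trailTerm {M' : Type*} [AddCommMonoid M'] (τ : B → M) (g : List B → M)
    (H : List B → M →+ M') (l : List B) :
    splitSum (fun u v => H v (trailTerm τ g u)) l =
      splitSum (fun u v => match v with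
        | [] => 0
        | y :: v => H v (g u * τ y)) l := by
  induction l generalizing g with
  | nil => simp [splitSum, trailTerm]
  | cons x l ih =>
    have h : splitSum (fun u v => H v (atNil (g [] * τ x) u)) l = H l (g [] * τ x) := by
      cases l with
      | nil => rfl
      | cons y l => simp [splitSum, atNil, splitSum_zero]
    simp [splitSum, trailTerm, ih, splitSum_add, h]

section Leibniz

variable [Mul B]

/-- The Hochschild coboundary is a derivation of the cup product of functions on words, up to
the terms `f(u) τ(x) g(v)`, which occur twice. -/
theorem wordDelta_cup (h2 : ∀ x : M, x + x = 0) (τ : B → M) (f g : List B → M) (l : List B) :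
    wordDelta τ (splitSum fun u v => f u * g v) l =
      splitSum (fun u v => wordDelta τ f u * g v) l +
        splitSum (fun u v => f u * wordDelta τ g v) l := by
  have hl : leadTerm τ (splitSum fun u v => f u * g v) l =
      splitSum (fun u v => leadTerm τ f u * g v) l := by
    cases l with
    | nil => simp [leadTerm, splitSum]
    | cons x l =>
      have := map_splitSum (AddMonoidHom.mulLeft (τ x)) (fun u v => f u * g v) l
      simpa [leadTerm, splitSum, mul_assoc] using this
  have hm : ∀ u v, mergeSum (fun z => f z * g v) u = mergeSum f u * g v := fun u v =>
    (map_mergeSum (AddMonoidHom.mulRight (g v)) f u).symm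
  have hm' : ∀ u v, mergeSum (fun z => f u * g z) v = f u * mergeSum g v := fun u v =>
    (map_mergeSum (AddMonoidHom.mulLeft (f u)) g v).symm
  have ht : ∀ u v, trailTerm τ (fun z => f u * g z) v = f u * trailTerm τ g v := fun u v =>
    (map_trailTerm (AddMonoidHom.mulLeft (f u)) τ τ (fun _ _ => by simp [mul_assoc]) g v).symm
  have hb : splitSum (fun u v => trailTerm τ f u * g v) l =
      splitSum (fun u v => f u * leadTerm τ g v) l := by
    have := splitSum_trailTerm τ f (fun v => AddMonoidHom.mulRight (g v)) l
    simp only [AddMonoidHom.mulRight_apply] at this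
    rw [this]
    congr 1
    funext u v
    cases v <;> simp [leadTerm, mul_assoc]
  simp only [wordDelta, mergeSum_splitSum, trailTerm_splitSum, hl, hm, hm', ht, add_mul, mul_add,
    splitSum_add, hb]
  linear_combination (norm := abel) -h2 (splitSum (fun u v => f u * leadTerm τ g v) l)

end Leibniz

section Insert

/-- The error term collects the factorizations in which `g` is inserted at the letter that is
split off in front. -/
theorem leadTerm_insertSum (t : B → B') (τ : B' → M) (g : List B → B') (F : List B' → M)
    (l : List B) :
    insertSum t g (leadTerm τ F) l = leadTerm (fun b => τ (t b)) (insertSum t g F) l +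
      splitSum (fun u v => τ (g u) * F (v.map t)) l := by
  cases l with
  | nil => simp [insertSum_nil, leadTerm, splitSum]
  | cons x l =>
    have h : τ (t x) * insertSum t g F l =
        insertSum t g (fun z => leadTerm τ F (t x :: z)) l := by
      refine (map_splitSum (AddMonoidHom.mulLeft (τ (t x))) _ l).trans ?_
      unfold insertSum
      congr 1; funext v r
      exact map_splitSum (AddMonoidHom.mulLeft (τ (t x))) _ r
    rw [insertSum_cons, add_comm, leadTerm, h]
    rfl

/-- The error term collects the factorizations in which `g` is inserted at the letter that is
split off at the end. -/
theorem trailTerm_insertSum (t : B → B') (τ : B' → M) (g : List B → B') (F : List B' → M)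
    (l : List B) :
    insertSum t g (trailTerm τ F) l = trailTerm (fun b => τ (t b)) (insertSum t g F) l +
      splitSum (fun u v => F (u.map t) * τ (g v)) l := by
  induction l generalizing F with
  | nil => simp [insertSum_nil, trailTerm, splitSum, atNil]
  | cons x l ih =>
    have hhead : headInsertSum t g (trailTerm τ F) (x :: l) =
        F [] * τ (g (x :: l)) +
          trailTerm (fun b => τ (t b)) (headInsertSum t g F) (x :: l) := by
      have hs : trailTerm (fun b => τ (t b)) (headInsertSum t g F) (x :: l) =
          splitSum (fun u v => trailTerm (fun b => τ (t b)) (fun z => F (g u :: z.map t)) v)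
            (x :: l) := trailTerm_splitSum _ _ _
      rw [hs]
      simp only [headInsertSum, trailTerm, splitSum_add]
      have e : ∀ (c : M) (w : List B), atNil c (w.map t) = atNil c w := fun c w => by
        cases w <;> rfl
      simp only [e, trailTerm_map, splitSum_atNil_right]
    have htail : insertSum t g (fun z => trailTerm τ F (t x :: z)) l =
        insertSum t g (trailTerm τ fun z => F (t x :: z)) l :=
      insertSum_congr t g (fun y z => by simp [trailTerm, atNil]) l
    have hnil : insertSum t g F [] = headInsertSum t g F [] := rfl
    rw [insertSum_cons, hhead, htail, ih]
    simp only [trailTerm, insertSum_cons, trailTerm_add, splitSum, List.map_cons, List.map_nil,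
      hnil]
    abel

/-- Multiplying two letters of the word either happens inside the inserted `g`, or away from it, or
multiplies `g` with the letter after it; the last kind is what `trailTerm t g` accounts for. -/
theorem mergeSum_headInsertSum [Mul B] [NonUnitalRing B']
    (t : B → B') (ht : ∀ x y, t (x * y) = t x * t y)
    (g : List B → B') {F : List B' → M} (hF : LetterAdditive F) (l : List B) :
    headInsertSum t g (mergeSum F) l + headInsertSum t (mergeSum g) F l =
      mergeSum (headInsertSum t g F) l + headInsertSum t (trailTerm t g) F l := by
  have h₁ : mergeSum (headInsertSum t g F) l = headInsertSum t (mergeSum g) F l +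
      splitSum (fun u v => mergeSum (fun z => F (g u :: z)) (v.map t)) l := by
    rw [headInsertSum, ← splitSum_add]
    refine (mergeSum_splitSum _ _).trans ?_
    congr 1; funext u v
    rw [mergeSum_map t ht]
    congr 1
    exact (map_mergeSum (hF.headHom (v.map t)) g u).symm
  have h₂ : headInsertSum t g (mergeSum F) l = headInsertSum t (trailTerm t g) F l +
      splitSum (fun u v => mergeSum (fun z => F (g u :: z)) (v.map t)) l := by
    have h := splitSum_trailTerm t g (fun v => hF.headHom (v.map t)) l
    have h' : headInsertSum t (trailTerm t g) F l = _ := h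
    rw [h', ← splitSum_add, headInsertSum]
    congr 1; funext u v
    cases v with
    | nil => simp [mergeSum]
    | cons y v => rfl
  rw [h₁, h₂]
  abel

theorem mergeSum_cons [Mul B'] (F : List B' → M) (x : B') (l : List B') :
    mergeSum F (x :: l) = scaleHead x F l + mergeSum (fun z => F (x :: z)) l := by
  cases l <;> simp [mergeSum, scaleHead]

/-- Multiplying two adjacent letters commutes with inserting `g`, except for the products of the
value of `g` with one of its neighbours and for the products of two letters inside `g`. -/
theorem mergeSum_insertSum [Mul B] [NonUnitalRing B']
    (t : B → B') (ht : ∀ x y, t (x * y) = t x * t y) (g : List B → B')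
    {F : List B' → M} (hF : LetterAdditive F) (l : List B) :
    insertSum t g (mergeSum F) l + insertSum t (mergeSum g) F l =
      mergeSum (insertSum t g F) l + insertSum t (leadTerm t g) F l +
        insertSum t (trailTerm t g) F l := by
  induction l generalizing F with
  | nil => simpa [insertSum_nil, mergeSum, leadTerm, trailTerm] using hF.zero [] []
  | cons x l ih =>
    have h₁ : insertSum t g (scaleHead (t x) F) l = headInsertSum t (leadTerm t g) F (x :: l) +
        scaleHead x (fun z => match z with
          | [] => 0
          | y :: z => insertSum t g (fun z => F (t y :: z)) z) l := by
      have hz : ∀ w, F (0 :: w) = 0 := hF.zero []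
      cases l with
      | nil => simp [insertSum_nil, headInsertSum, splitSum, leadTerm, scaleHead, hz]
      | cons y l =>
        simp only [insertSum_cons, headInsertSum, splitSum, leadTerm, scaleHead, hz, zero_add, ht]
    have h₂ : mergeSum (insertSum t g F) (x :: l) = mergeSum (headInsertSum t g F) (x :: l) +
        mergeSum (insertSum t g fun z => F (t x :: z)) l +
        scaleHead x (fun z => match z with
          | [] => 0
          | y :: z => insertSum t g (fun z => F (t y :: z)) z) l := by
      cases l with
      | nil => simp [mergeSum, scaleHead]
      | cons y l =>
        simp only [mergeSum, insertSum_cons, mergeSum_add, scaleHead]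
        abel
    have h₃ := mergeSum_headInsertSum t ht g hF (x :: l)
    have h₄ := ih (hF.cons (t x))
    have h₅ : insertSum t g (mergeSum F) (x :: l) =
        headInsertSum t g (mergeSum F) (x :: l) + (insertSum t g (scaleHead (t x) F) l +
          insertSum t g (mergeSum fun z => F (t x :: z)) l) := by
      simp only [insertSum_cons, mergeSum_cons, insertSum_add]
    rw [h₅, h₁, h₂, insertSum_cons, insertSum_cons, insertSum_cons]
    linear_combination (norm := abel) h₃ + h₄

/-- The Hochschild coboundary is a derivation of the insertion product, up to the two products
of the values of `g` and of `F` in which `g` is inserted in an outer place. -/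
theorem wordDelta_insertSum [Mul B] [NonUnitalRing B'] (h2 : ∀ x : M, x + x = 0) (t : B → B')
    (ht : ∀ x y, t (x * y) = t x * t y) (τ : B' → M) (g : List B → B') {F : List B' → M}
    (hF : LetterAdditive F) (l : List B) :
    wordDelta (fun b => τ (t b)) (insertSum t g F) l =
      insertSum t g (wordDelta τ F) l + insertSum t (wordDelta t g) F l +
        splitSum (fun u v => F (u.map t) * τ (g v)) l +
        splitSum (fun u v => τ (g u) * F (v.map t)) l := by
  have h₁ := leadTerm_insertSum t τ g F l
  have h₂ := trailTerm_insertSum t τ g F l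
  have h₃ := mergeSum_insertSum t ht g hF l
  have h₄ : insertSum t g (wordDelta τ F) l = insertSum t g (leadTerm τ F) l +
      insertSum t g (mergeSum F) l + insertSum t g (trailTerm τ F) l := by
    simp only [← insertSum_add]; rfl
  have h₅ : insertSum t (wordDelta t g) F l = insertSum t (leadTerm t g) F l +
      insertSum t (mergeSum g) F l + insertSum t (trailTerm t g) F l := by
    simp only [← insertSum_add_inner _ _ _ hF]; rfl
  rw [h₄, h₅, wordDelta, h₁, h₂]
  linear_combination (norm := abel) -h₃ - h2 (insertSum t (leadTerm t g) F l) -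
    h2 (insertSum t (trailTerm t g) F l) -
    h2 (splitSum (fun u v => F (u.map t) * τ (g v)) l) -
    h2 (splitSum (fun u v => τ (g u) * F (v.map t)) l)

end Insert

end Ring

theorem trailTerm_cons {B M : Type*} [NonUnitalRing M] (τ : B → M) (F : List B → M) (x : B)
    (l : List B) :
    trailTerm τ F (x :: l) = F (x :: l).dropLast * τ ((x :: l).getLast (by simp)) := by
  induction l generalizing x F with
  | nil => simp [trailTerm, atNil]
  | cons y l ih => rw [trailTerm, ih]; simp [atNil]

theorem insertSum_eq_sum {B B' M : Type*} [AddCommMonoid M] (t : B → B') (g : List B → B')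
    (F : List B' → M) (l : List B) :
    insertSum t g F l = ∑ i ∈ Finset.range (l.length + 1),
      ∑ j ∈ Finset.range (l.length - i + 1),
        F ((l.take i).map t ++ g ((l.drop i).take j) :: (l.drop (i + j)).map t) := by
  simp [insertSum, splitSum_eq_sum, List.drop_drop]

theorem splitSum_map {B B' M : Type*} [AddCommMonoid M] (t : B → B')
    (Φ : List B' → List B' → M) (l : List B) :
    splitSum Φ (l.map t) = splitSum (fun u v => Φ (u.map t) (v.map t)) l := by
  simp only [splitSum_eq_sum, List.length_map, List.map_take, List.map_drop]

theorem map_insertSum {B B' B'' M M' : Type*} [AddCommMonoid M] [AddCommMonoid M'] (T : M →+ M')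
    (t : B' → B'') (t' : B → B') (g : List B' → B'') (F : List B'' → M) (l : List B) :
    T (insertSum t g F (l.map t')) =
      insertSum (fun b => t (t' b)) (fun z => g (z.map t')) (fun z => T (F z)) l := by
  simp only [insertSum_eq_sum, map_sum, List.length_map, List.map_take, List.map_drop,
    List.map_map]
  rfl

theorem insertSum_comp_map {B B' B'' M : Type*} [AddCommMonoid M] (t : B → B') (r : B' → B'')
    (g : List B → B') (F : List B'' → M) (l : List B) :
    insertSum t g (fun z => F (z.map r)) l =
      insertSum (fun b => r (t b)) (fun z => r (g z)) F l := by
  simp only [insertSum, List.map_append, List.map_cons, List.map_map]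
  rfl

theorem insertSum_zero {B B' M : Type*} [AddCommMonoid M] (t : B → B') (g : List B → B')
    (l : List B) : insertSum t g (fun _ => (0 : M)) l = 0 := by
  simp only [insertSum, splitSum_zero]

theorem insertSum_zero_inner {B B' M : Type*} [AddMonoid B'] [AddCommGroup M] (t : B → B')
    {F : List B' → M} (hF : LetterAdditive F) (l : List B) :
    insertSum t (fun _ => 0) F l = 0 := by
  simp only [insertSum, hF.zero, splitSum_zero]

theorem insertSum_sum {B B' M ι : Type*} [AddCommMonoid M] (s : Finset ι) (t : B → B')
    (g : List B → B') (F : ι → List B' → M) (l : List B) :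
    insertSum t g (fun z => ∑ i ∈ s, F i z) l = ∑ i ∈ s, insertSum t g (F i) l := by
  classical
  induction s using Finset.induction_on with
  | empty => simp [insertSum_zero]
  | insert i s hi ih => simp [Finset.sum_insert hi, insertSum_add, ih]

theorem insertSum_sum_inner {B B' M ι : Type*} [AddCommMonoid B'] [AddCommGroup M] (s : Finset ι)
    (t : B → B') (g : ι → List B → B') {F : List B' → M} (hF : LetterAdditive F) (l : List B) :
    insertSum t (fun z => ∑ i ∈ s, g i z) F l = ∑ i ∈ s, insertSum t (g i) F l := by
  classical
  induction s using Finset.induction_on with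
  | empty => simp [insertSum_zero_inner _ hF]
  | insert i s hi ih => simp [Finset.sum_insert hi, insertSum_add_inner _ _ _ hF, ih]

theorem splitSum_sum {B M ι : Type*} [AddCommMonoid M] (s : Finset ι)
    (Φ : ι → List B → List B → M) (l : List B) :
    splitSum (fun u v => ∑ i ∈ s, Φ i u v) l = ∑ i ∈ s, splitSum (Φ i) l := by
  simp only [splitSum_eq_sum]
  rw [Finset.sum_comm]

end Words

/-! ### Evaluation of cochains on the faces of a simplex -/

section FaceValues

variable {𝕜 : Type u} [Field 𝕜] {C : Type v₁} [Category.{v₂} C]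
  {𝒜 : C ⥤ NonUnitalAlgCat.{u, w} 𝕜}

theorem transport_refl {N : ℕ} (φ : Nerve C N) (i : Fin (N + 1)) (h : i ≤ i)
    (a : 𝒜.obj (φ.vertex i)) : transport 𝒜 φ h a = a := by
  have : φ.edge h = 𝟙 _ := by
    unfold Nerve.edge
    exact φ.map_id _
  unfold transport
  rw [this, 𝒜.map_id]
  rfl

theorem transport_trans {N : ℕ} (φ : Nerve C N) {i j k : Fin (N + 1)} (h : i ≤ j) (h' : j ≤ k)
    (a : 𝒜.obj (φ.vertex k)) :
    transport 𝒜 φ h (transport 𝒜 φ h' a) = transport 𝒜 φ (h.trans h') a := by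
  have : φ.edge (h.trans h') = φ.edge h' ≫ φ.edge h := by
    unfold Nerve.edge
    rw [← φ.map_comp]
    rfl
  unfold transport
  rw [this, 𝒜.map_comp]
  rfl

theorem transport_mul {N : ℕ} (φ : Nerve C N) {i j : Fin (N + 1)} (h : i ≤ j)
    (a b : 𝒜.obj (φ.vertex j)) :
    transport 𝒜 φ h (a * b) = transport 𝒜 φ h a * transport 𝒜 φ h b :=
  map_mul (show 𝒜.obj (φ.vertex j) →ₙₐ[𝕜] 𝒜.obj (φ.vertex i) from 𝒜.map (φ.edge h)) a b

/-- The value at `φ` of the component of `F` indexed by `ζ`, with inputs in `𝒜(x_e)` and output in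
`𝒜(x_s)`: the transported value `𝒜[φ_{s,ζ(0)}] (F[ζ^*φ] (𝒜[φ_{ζ(p),e}] a₁, …))`. -/
def evalOn (F : BiCochain 𝒜) {N p : ℕ} (φ : Nerve C N) (ζ : Fin (p + 1) →o Fin (N + 1))
    {s e : Fin (N + 1)} (hs : s ≤ ζ 0) (he : ζ (Fin.last p) ≤ e) {q : ℕ}
    (a : Fin q → 𝒜.obj (φ.vertex e)) : 𝒜.obj (φ.vertex s) :=
  transport 𝒜 φ hs (F p q (φ.pull ζ) fun i => transport 𝒜 φ he (a i))

open Classical in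
/-- The value of `F` on the face of `φ` with vertex set `S`, transported to `x_s`, at a word of
elements of `𝒜(x_e)`. The bidegree is read off from `S` and the length of the word. It is `0` if
`S` is empty or has a vertex that is not between `s` and `e`. -/
noncomputable def faceVal (F : BiCochain 𝒜) {N : ℕ} (φ : Nerve C N) (S : Finset (Fin (N + 1)))
    (s e : Fin (N + 1)) (l : List (𝒜.obj (φ.vertex e))) : 𝒜.obj (φ.vertex s) :=
  if h : S.Nonempty ∧ ∀ x ∈ S, s ≤ x ∧ x ≤ e then
    have hc : S.card = S.card - 1 + 1 := (Nat.sub_add_cancel h.1.card_pos).symm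
    evalOn F φ (S.orderEmbOfFin hc).toOrderHom (h.2 _ (S.orderEmbOfFin_mem hc _)).1
      (h.2 _ (S.orderEmbOfFin_mem hc _)).2 l.get
  else 0

/-- The length of the face and that of the word are not determined definitionally, hence the
equations `hp` and `hq`. -/
theorem evalOn_congr (F : BiCochain 𝒜) {N : ℕ} (φ : Nerve C N) {s e : Fin (N + 1)} {p p' : ℕ}
    (hp : p = p') (ζ : Fin (p + 1) →o Fin (N + 1)) (ζ' : Fin (p' + 1) →o Fin (N + 1))
    (hζ : ∀ j, ζ j = ζ' (Fin.cast (by omega) j)) (hs : s ≤ ζ 0) (he : ζ (Fin.last p) ≤ e)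
    (hs' : s ≤ ζ' 0) (he' : ζ' (Fin.last p') ≤ e) {q q' : ℕ} (hq : q = q')
    (a : Fin q → 𝒜.obj (φ.vertex e)) (a' : Fin q' → 𝒜.obj (φ.vertex e))
    (ha : ∀ i, a i = a' (Fin.cast hq i)) :
    evalOn F φ ζ hs he a = evalOn F φ ζ' hs' he' a' := by
  subst hp hq
  obtain rfl : ζ = ζ' := by ext j; simp [hζ j]
  obtain rfl : a = a' := by ext j; simp [ha j]
  rfl

/-- `faceVal` can be computed with any strictly increasing parametrization of the
set of vertices. -/
theorem faceVal_eq_evalOn (F : BiCochain 𝒜) {N p q : ℕ} (φ : Nerve C N)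
    (ζ : Fin (p + 1) →o Fin (N + 1)) (hζ : StrictMono ζ) {S : Finset (Fin (N + 1))}
    (hS : ∀ x, x ∈ S ↔ ∃ j, ζ j = x) {s e : Fin (N + 1)} (hs : s ≤ ζ 0)
    (he : ζ (Fin.last p) ≤ e) {l : List (𝒜.obj (φ.vertex e))} (a : Fin q → 𝒜.obj (φ.vertex e))
    (hl : l = List.ofFn a) : faceVal F φ S s e l = evalOn F φ ζ hs he a := by
  subst hl
  have hmap : S = Finset.univ.map ⟨ζ, hζ.injective⟩ := by
    ext x; simp [hS]
  have hcard : S.card = p + 1 := by simp [hmap]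
  have h : S.Nonempty ∧ ∀ x ∈ S, s ≤ x ∧ x ≤ e := by
    refine ⟨Finset.card_pos.mp (by omega), fun x hx => ?_⟩
    obtain ⟨j, rfl⟩ := (hS x).mp hx
    exact ⟨hs.trans (ζ.monotone (Fin.zero_le j)), (ζ.monotone (Fin.le_last j)).trans he⟩
  rw [faceVal, dif_pos h]
  have hp : p = S.card - 1 := by omega
  subst hp
  refine evalOn_congr F φ rfl _ _ (fun j => ?_) _ _ _ _ (List.length_ofFn ..) _ _ (fun i => ?_)
  · have := Finset.orderEmbOfFin_unique (Nat.sub_add_cancel h.1.card_pos).symm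
      (fun x => (hS _).mpr ⟨x, rfl⟩) hζ
    exact (congrFun this j).symm
  · simp only [List.get_ofFn]

theorem exists_face {N : ℕ} {S : Finset (Fin (N + 1))} (hS : S.Nonempty) :
    ∃ (p : ℕ) (ζ : Fin (p + 1) →o Fin (N + 1)), StrictMono ζ ∧ ∀ x, x ∈ S ↔ ∃ j, ζ j = x := by
  have hc : S.card = S.card - 1 + 1 := (Nat.sub_add_cancel hS.card_pos).symm
  refine ⟨S.card - 1, (S.orderEmbOfFin hc).toOrderHom, (S.orderEmbOfFin hc).strictMono,
    fun x => ?_⟩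
  have := Set.ext_iff.mp (S.range_orderEmbOfFin hc) x
  exact this.symm

theorem faceVal_empty (F : BiCochain 𝒜) {N : ℕ} (φ : Nerve C N) (s e : Fin (N + 1))
    (l : List (𝒜.obj (φ.vertex e))) : faceVal F φ ∅ s e l = 0 := by
  simp [faceVal]

theorem faceVal_add (F G : BiCochain 𝒜) {N : ℕ} (φ : Nerve C N) (S : Finset (Fin (N + 1)))
    (s e : Fin (N + 1)) (l : List (𝒜.obj (φ.vertex e))) :
    faceVal (F + G) φ S s e l = faceVal F φ S s e l + faceVal G φ S s e l := by
  unfold faceVal evalOn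
  split_ifs
  · exact map_add _ _ _
  · exact (add_zero 0).symm

theorem evalOn_id (F : BiCochain 𝒜) {N q : ℕ} (φ : Nerve C N)
    (a : Fin q → 𝒜.obj (φ.vertex (Fin.last N))) :
    evalOn F φ OrderHom.id (le_refl 0) (le_refl (Fin.last N)) a = F N q φ a := by
  refine (transport_refl φ 0 _ _).trans ?_
  congr 1
  funext i
  exact transport_refl φ (Fin.last N) _ _

theorem faceVal_univ (F : BiCochain 𝒜) {N : ℕ} (φ : Nerve C N)
    (l : List (𝒜.obj (φ.vertex (Fin.last N)))) :
    faceVal F φ Finset.univ 0 (Fin.last N) l = F N l.length φ l.get := by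
  rw [faceVal_eq_evalOn F φ OrderHom.id strictMono_id (by simp) (le_refl 0) (le_refl (Fin.last N))
    l.get (List.ofFn_get l).symm, evalOn_id]

/-- A family of cochains is determined by its values on the full vertex set of every simplex. -/
theorem biCochain_ext {F G : BiCochain 𝒜}
    (h : ∀ (N : ℕ) (φ : Nerve C N) (l : List (𝒜.obj (φ.vertex (Fin.last N)))),
      faceVal F φ Finset.univ 0 (Fin.last N) l = faceVal G φ Finset.univ 0 (Fin.last N) l) :
    F = G := by
  funext N q φ
  ext a
  have key : ∀ (F : BiCochain 𝒜),
      faceVal F φ Finset.univ 0 (Fin.last N) (List.ofFn a) = F N q φ a := fun F => by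
    rw [faceVal_eq_evalOn F φ OrderHom.id strictMono_id (by simp) (le_refl 0)
      (le_refl (Fin.last N)) a rfl, evalOn_id]
  rw [← key F, ← key G, h]

/-- The output of `faceVal` may be transported to any vertex in front of the face. -/
theorem transport_faceVal (F : BiCochain 𝒜) {N : ℕ} (φ : Nerve C N) {S : Finset (Fin (N + 1))}
    {s s' : Fin (N + 1)} (h : s ≤ s') (hS : ∀ x ∈ S, s' ≤ x) (e : Fin (N + 1))
    (l : List (𝒜.obj (φ.vertex e))) :
    transport 𝒜 φ h (faceVal F φ S s' e l) = faceVal F φ S s e l := by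
  by_cases hc : S.Nonempty ∧ ∀ x ∈ S, x ≤ e
  · rw [faceVal, faceVal, dif_pos ⟨hc.1, fun x hx => ⟨hS x hx, hc.2 x hx⟩⟩,
      dif_pos ⟨hc.1, fun x hx => ⟨h.trans (hS x hx), hc.2 x hx⟩⟩]
    exact transport_trans φ h _ _
  · have h₁ : ∀ s : Fin (N + 1), ¬ (S.Nonempty ∧ ∀ x ∈ S, s ≤ x ∧ x ≤ e) :=
      fun s h => hc ⟨h.1, fun x hx => (h.2 x hx).2⟩
    rw [faceVal, faceVal, dif_neg (h₁ _), dif_neg (h₁ _), map_zero]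

/-- The inputs of `faceVal` may be taken at any vertex behind the face. -/
theorem faceVal_map_transport (F : BiCochain 𝒜) {N : ℕ} (φ : Nerve C N)
    {S : Finset (Fin (N + 1))} {e e' : Fin (N + 1)} (h : e ≤ e') (hS : ∀ x ∈ S, x ≤ e)
    (s : Fin (N + 1)) (l : List (𝒜.obj (φ.vertex e'))) :
    faceVal F φ S s e (l.map (transport 𝒜 φ h)) = faceVal F φ S s e' l := by
  by_cases hc : S.Nonempty ∧ ∀ x ∈ S, s ≤ x
  · obtain ⟨p, ζ, hζ, hζS⟩ := exists_face hc.1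
    have hs : s ≤ ζ 0 := hc.2 _ ((hζS _).mpr ⟨_, rfl⟩)
    have he : ζ (Fin.last p) ≤ e := hS _ ((hζS _).mpr ⟨_, rfl⟩)
    rw [faceVal_eq_evalOn F φ ζ hζ hζS hs (he.trans h) l.get (List.ofFn_get l).symm,
      faceVal_eq_evalOn F φ ζ hζ hζS hs he (fun i => transport 𝒜 φ h (l.get i))
        (by simp)]
    simp only [evalOn, transport_trans]
  · have h₁ : ∀ e : Fin (N + 1), ¬ (S.Nonempty ∧ ∀ x ∈ S, s ≤ x ∧ x ≤ e) :=
      fun e h => hc ⟨h.1, fun x hx => (h.2 x hx).1⟩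
    rw [faceVal, faceVal, dif_neg (h₁ _), dif_neg (h₁ _)]

theorem append_cons_eq_ofFn {B : Type*} (u w : List B) (x y : B) :
    u ++ x :: w = List.ofFn (Function.update (u ++ y :: w).get ⟨u.length, by simp⟩ x) := by
  apply List.ext_getElem
  · simp [Nat.add_assoc]
  · intro i h₁ h₂
    simp only [List.getElem_ofFn, Function.update_apply, Fin.mk.injEq, List.get_eq_getElem]
    split_ifs with h
    · subst h; simp
    · rcases lt_or_gt_of_ne h with h | h
      · simp [List.getElem_append_left h]
      · rw [List.getElem_append_right h.le, List.getElem_append_right h.le]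
        obtain ⟨k, hk⟩ : ∃ k, i - u.length = k + 1 := ⟨i - u.length - 1, by omega⟩
        simp [hk]

theorem letterAdditive_faceVal (F : BiCochain 𝒜) {N : ℕ} (φ : Nerve C N)
    (S : Finset (Fin (N + 1))) (s e : Fin (N + 1)) : LetterAdditive (faceVal F φ S s e) := by
  intro u a b w
  by_cases hc : S.Nonempty ∧ ∀ x ∈ S, s ≤ x ∧ x ≤ e
  · obtain ⟨p, ζ, hζ, hζS⟩ := exists_face hc.1
    have hb := fun j => hc.2 (ζ j) ((hζS _).mpr ⟨_, rfl⟩)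
    have key := fun x => faceVal_eq_evalOn F φ ζ hζ hζS (hb 0).1 (hb (Fin.last p)).2 _
      (append_cons_eq_ofFn u w x 0)
    have hu := fun x => congrArg (transport 𝒜 φ (hb 0).1)
      (((F p (u ++ 0 :: w).length (φ.pull ζ)).compLinearMap
        (fun _ => transport 𝒜 φ (hb (Fin.last p)).2)).map_update_add
          (u ++ 0 :: w).get ⟨u.length, by simp⟩ a x)
    rw [key, key, key]
    exact (hu b).trans (map_add _ _ _)
  · simp only [faceVal, dif_neg hc, add_zero]

section CharTwo

variable [CharP 𝕜 2]

theorem add_self_eq_zero_of_charTwo (𝕜 : Type u) [Field 𝕜] [CharP 𝕜 2] {M : Type*}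
    [AddCommGroup M] [Module 𝕜 M] (x : M) : x + x = 0 := by
  rw [← two_smul 𝕜 x, CharTwo.two_eq_zero, zero_smul]

theorem neg_one_pow_eq_one_of_charTwo (n : ℕ) : (-1 : 𝕜) ^ n = 1 := by
  rw [CharTwo.neg_eq, one_pow]

theorem circ_apply {p₁ q₁ p₂ q₂ p q : ℕ} (hp : p₁ + p₂ = p) (hq : q₁ + q₂ = q + 1)
    (f : Cochain 𝒜 p₁ q₁) (g : Cochain 𝒜 p₂ q₂) (φ : Nerve C p)
    (a : Fin q → 𝒜.obj (φ.vertex (Fin.last p))) :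
    circ hp hq f g φ a = ∑ i : Fin q₁, transport 𝒜 φ (Fin.zero_le (front hp 0))
      (f (φ.pull (front hp)) (insertArgs hq i
        (fun b => transport 𝒜 φ (show front hp (Fin.last p₁) ≤ back hp 0 from Nat.le_refl p₁)
          (g (φ.pull (back hp)) fun l =>
            transport 𝒜 φ (Fin.le_last (back hp (Fin.last p₂))) (b l)))
        (transport 𝒜 φ (Fin.le_last (front hp (Fin.last p₁)))) a)) := by
  simp only [circ, neg_one_pow_eq_one_of_charTwo, one_smul, sum_apply]
  rfl

theorem deltaS_apply {p q : ℕ} (f : Cochain 𝒜 p q) (φ : Nerve C (p + 1))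
    (a : Fin q → 𝒜.obj (φ.vertex (Fin.last (p + 1)))) :
    deltaS f φ a = ∑ i : Fin (p + 2), act (Fin.succAboveOrderEmb i).toOrderHom f φ a := by
  simp only [deltaS, neg_one_pow_eq_one_of_charTwo, one_smul, Finset.sum_apply,
    sum_apply]

theorem bullet_apply {p₁ q₁ p₂ q₂ p q : ℕ} (hp : p₁ + p₂ = p + 1) (hq : q₁ + q₂ = q)
    (f : Cochain 𝒜 p₁ q₁) (g : Cochain 𝒜 p₂ q₂) (h₂ : 1 ≤ p₂) (φ : Nerve C p)
    (a : Fin q → 𝒜.obj (φ.vertex (Fin.last p))) :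
    bullet hp hq f g φ a = ∑ c : Fin p₁,
      act (inner hp c) g φ (fun l => a ⟨l.1, by omega⟩) *
        act (outer hp c h₂) f φ (fun l => a ⟨q₂ + l.1, by omega⟩) := by
  simp only [bullet, dif_pos h₂, neg_one_pow_eq_one_of_charTwo, one_smul, sum_apply]
  rfl

end CharTwo

end FaceValues

/-! ### The operations in terms of faces and words -/

section Expansion

variable {𝕜 : Type u} [Field 𝕜] {C : Type v₁} [Category.{v₂} C]
  {𝒜 : C ⥤ NonUnitalAlgCat.{u, w} 𝕜}

theorem ofFn_insertArgs {U W : Type w} {q₁ q₂ : ℕ} (l : List U) (hq : q₁ + q₂ = l.length + 1)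
    (i : Fin q₁) (G : (Fin q₂ → U) → W) (t : U → W) :
    List.ofFn (insertArgs hq i G t l.get) =
      (l.take i).map t ++ G (fun j => l[i.1 + j.1]'(by omega)) :: (l.drop (i + q₂)).map t := by
  apply List.ext_getElem
  · simp; omega
  · intro n h₁ h₂
    rw [List.getElem_ofFn]
    simp only [insertArgs, List.get_eq_getElem]
    have hi : ((l.take i).map t).length = i := by simp; omega
    split_ifs with h h'
    · rw [List.getElem_append_left (by omega)]; simp
    · rw [List.getElem_append_right (by omega)]
      simp only [hi, h', Nat.sub_self, List.getElem_cons_zero]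
    · rw [List.getElem_append_right (by omega)]
      obtain ⟨k, hk⟩ : ∃ k, n = i.1 + (k + 1) := ⟨n - i.1 - 1, by omega⟩
      subst hk
      simp only [hi, Nat.add_sub_cancel_left, List.getElem_cons_succ, List.getElem_map,
        List.getElem_drop]
      congr 2
      omega

theorem ofFn_getElem_drop_take {U : Type*} (l : List U) (i n : ℕ) (h : i + n ≤ l.length) :
    List.ofFn (fun j : Fin n => l[i + j.1]'(by omega)) = (l.drop i).take n := by
  apply List.ext_getElem
  · simp; omega
  · intro k h₁ h₂
    simp

theorem sum_antidiagonal_eq_sum_fin {M : Type*} [AddCommMonoid M] (N : ℕ)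
    (E : Finset.HasAntidiagonal.antidiagonal N → M) :
    ∑ x, E x = ∑ m : Fin (N + 1), E ⟨(m.1, N - m.1), by
      rw [Finset.HasAntidiagonal.mem_antidiagonal]; dsimp only; omega⟩ := by
  symm
  have hmem : ∀ m : Fin (N + 1), (m.1, N - m.1) ∈ Finset.HasAntidiagonal.antidiagonal N :=
    fun m => by rw [Finset.HasAntidiagonal.mem_antidiagonal]; dsimp only; omega
  refine Fintype.sum_bijective (fun m : Fin (N + 1) => ⟨(m.1, N - m.1), hmem m⟩) ⟨?_, ?_⟩
    (fun m => E ⟨(m.1, N - m.1), hmem m⟩) E fun m => rfl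
  · intro a b h
    simpa [Fin.ext_iff] using congrArg (fun x => x.1.1) h
  · rintro ⟨⟨a, b⟩, h⟩
    have h' := Finset.HasAntidiagonal.mem_antidiagonal.mp h
    dsimp only at h'
    refine ⟨⟨a, by omega⟩, ?_⟩
    simp; omega

theorem sum_antidiagonal_succ_sum_fin {M : Type*} [AddCommMonoid M] (n : ℕ) (K : ℕ → ℕ → M) :
    ∑ y : Finset.HasAntidiagonal.antidiagonal (n + 1), ∑ i : Fin y.1.1, K i y.1.2 =
      ∑ i ∈ Finset.range (n + 1), ∑ j ∈ Finset.range (n - i + 1), K i j := by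
  rw [Finset.sum_coe_sort (Finset.HasAntidiagonal.antidiagonal (n + 1))
    (fun y => ∑ i : Fin y.1, K i y.2)]
  simp only [← fun y : ℕ × ℕ => Finset.sum_range fun i => K i y.2]
  rw [Finset.sum_sigma', Finset.sum_sigma']
  refine Finset.sum_bij' (fun z _ => ⟨z.2, z.1.2⟩) (fun z _ => ⟨(n + 1 - z.2, z.2), z.1⟩)
    ?_ ?_ ?_ ?_ ?_
  · rintro ⟨⟨a, b⟩, i⟩ h
    simp only [Finset.mem_sigma, Finset.HasAntidiagonal.mem_antidiagonal, Finset.mem_range] at h ⊢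
    omega
  · rintro ⟨i, j⟩ h
    simp only [Finset.mem_sigma, Finset.HasAntidiagonal.mem_antidiagonal, Finset.mem_range] at h ⊢
    omega
  · rintro ⟨⟨a, b⟩, i⟩ h
    simp only [Finset.mem_sigma, Finset.HasAntidiagonal.mem_antidiagonal, Finset.mem_range] at h ⊢
    simp; omega
  · rintro ⟨i, j⟩ h
    rfl
  · rintro ⟨⟨a, b⟩, i⟩ h
    rfl

theorem insertSum_eq_sum_antidiagonal {B B' M : Type*} [AddCommMonoid M] (t : B → B')
    (g : List B → B') (F : List B' → M) (l : List B) :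
    insertSum t g F l =
      ∑ y : Finset.HasAntidiagonal.antidiagonal (l.length + 1), ∑ i : Fin y.1.1,
        F ((l.take i).map t ++ g ((l.drop i).take y.1.2) :: (l.drop (i + y.1.2)).map t) := by
  rw [insertSum_eq_sum, ← sum_antidiagonal_succ_sum_fin l.length]

theorem splitSum_eq_sum_antidiagonal {B M : Type*} [AddCommMonoid M]
    (Φ : List B → List B → M) (l : List B) :
    splitSum Φ l = ∑ y : Finset.HasAntidiagonal.antidiagonal l.length,
      Φ (l.take y.1.1) (l.drop y.1.1) := by
  rw [splitSum_eq_sum, sum_antidiagonal_eq_sum_fin, Finset.sum_range]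

variable (F G : BiCochain 𝒜)

/-- The value of an insertion `F ∘ᵢ G` in terms of words. -/
theorem insertArgs_faceVal {N p₁ p₂ q₁ q₂ : ℕ} (φ : Nerve C N) (hp : p₁ + p₂ = N)
    (l : List (𝒜.obj (φ.vertex (Fin.last N)))) (hq : q₁ + q₂ = l.length + 1) (i : Fin q₁)
    (m : Fin (N + 1)) (hm : m.1 = p₁) :
    transport 𝒜 φ (Fin.zero_le (front hp 0))
      (F p₁ q₁ (φ.pull (front hp)) (insertArgs hq i
        (fun b => transport 𝒜 φ (show front hp (Fin.last p₁) ≤ back hp 0 from Nat.le_refl p₁)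
          (G p₂ q₂ (φ.pull (back hp)) fun l =>
            transport 𝒜 φ (Fin.le_last (back hp (Fin.last p₂))) (b l)))
        (transport 𝒜 φ (Fin.le_last (front hp (Fin.last p₁)))) l.get)) =
      faceVal F φ (Finset.Iic m) 0 m ((l.take i).map (transport 𝒜 φ (Fin.le_last m)) ++
        faceVal G φ (Finset.Ici m) m (Fin.last N) ((l.drop i).take q₂) ::
          (l.drop (i + q₂)).map (transport 𝒜 φ (Fin.le_last m))) := by
  obtain rfl : m = front hp (Fin.last p₁) := Fin.ext hm
  have hG : ∀ b : Fin q₂ → 𝒜.obj (φ.vertex (Fin.last N)),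
      faceVal G φ (Finset.Ici (front hp (Fin.last p₁))) (front hp (Fin.last p₁)) (Fin.last N)
        (List.ofFn b) = transport 𝒜 φ (show front hp (Fin.last p₁) ≤ back hp 0 from Nat.le_refl p₁)
          (G p₂ q₂ (φ.pull (back hp)) fun l =>
            transport 𝒜 φ (Fin.le_last (back hp (Fin.last p₂))) (b l)) := fun b => by
    refine faceVal_eq_evalOn G φ (back hp) ?_ ?_ _ _ b rfl
    · intro x y h
      exact Nat.add_lt_add_left h p₁
    · intro x
      rw [Finset.mem_Ici]
      constructor
      · intro h
        have h' : p₁ ≤ x.1 := h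
        exact ⟨⟨x.1 - p₁, by omega⟩, Fin.ext (Nat.add_sub_cancel' h')⟩
      · rintro ⟨j, rfl⟩
        exact Nat.le_add_right p₁ j
  rw [faceVal_eq_evalOn F φ (front hp) (fun _ _ h => h) ?_ (Fin.zero_le _) (le_refl _) _
    ((ofFn_insertArgs l hq i (fun b => faceVal G φ (Finset.Ici (front hp (Fin.last p₁)))
      (front hp (Fin.last p₁)) (Fin.last N) (List.ofFn b))
      (transport 𝒜 φ (Fin.le_last (front hp (Fin.last p₁))))).trans ?_).symm]
  · simp only [hG]
    unfold evalOn
    congr 2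
    funext j
    exact (transport_refl φ _ _ _).symm
  · intro x
    rw [Finset.mem_Iic]
    constructor
    · intro h
      exact ⟨⟨x.1, Nat.lt_succ_of_le h⟩, rfl⟩
    · rintro ⟨j, rfl⟩
      exact Nat.le_of_lt_succ j.2
  · rw [ofFn_getElem_drop_take l i q₂ (by omega)]

/-- The part `F ∘ G` of the composition operation. -/
def circTotal : BiCochain 𝒜 := fun p q =>
  ∑ x : Finset.HasAntidiagonal.antidiagonal p,
    ∑ y : Finset.HasAntidiagonal.antidiagonal (q + 1),
      circ (Finset.HasAntidiagonal.mem_antidiagonal.mp x.2)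
        (Finset.HasAntidiagonal.mem_antidiagonal.mp y.2)
        (F x.1.1 y.1.1) (G x.1.2 y.1.2)

/-- The part `F • G` of the composition operation. -/
def bulletTotal : BiCochain 𝒜 := fun p q =>
  ∑ x : Finset.HasAntidiagonal.antidiagonal (p + 1),
    ∑ y : Finset.HasAntidiagonal.antidiagonal q,
      bullet (Finset.HasAntidiagonal.mem_antidiagonal.mp x.2)
        (Finset.HasAntidiagonal.mem_antidiagonal.mp y.2)
        (F x.1.1 y.1.1) (G x.1.2 y.1.2)

/-- The cup product `F ⌣ G`: on `x₀ ← ⋯ ← x_p`, it is the sum of the products of `F` on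
`x₀ ← ⋯ ← x_m` with `G` on `x_m ← ⋯ ← x_p`. -/
def cup : BiCochain 𝒜 := fun p q φ =>
  ∑ x : Finset.HasAntidiagonal.antidiagonal p, ∑ y : Finset.HasAntidiagonal.antidiagonal q,
    mulMap ((add_comm _ _).trans (Finset.HasAntidiagonal.mem_antidiagonal.mp y.2))
      (act (front (Finset.HasAntidiagonal.mem_antidiagonal.mp x.2)) (F x.1.1 y.1.1) φ)
      (act (back (Finset.HasAntidiagonal.mem_antidiagonal.mp x.2)) (G x.1.2 y.1.2) φ)

theorem compBar_eq : compBar F G = circTotal F G + bulletTotal F G := rfl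

/-- In `f ∘ g` the simplex is cut at the vertex `m`: `f` lives on the vertices up to `m`, and `g`
on those from `m` on. -/
theorem faceVal_circTotal_univ [CharP 𝕜 2] {N : ℕ} (φ : Nerve C N)
    (l : List (𝒜.obj (φ.vertex (Fin.last N)))) :
    faceVal (circTotal F G) φ Finset.univ 0 (Fin.last N) l =
      ∑ m, insertSum (transport 𝒜 φ (Fin.le_last m)) (faceVal G φ (Finset.Ici m) m (Fin.last N))
        (faceVal F φ (Finset.Iic m) 0 m) l := by
  rw [faceVal_univ]
  simp only [circTotal, Finset.sum_apply, sum_apply]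
  rw [sum_antidiagonal_eq_sum_fin]
  refine Finset.sum_congr rfl fun m _ => ?_
  rw [insertSum_eq_sum_antidiagonal]
  refine Finset.sum_congr rfl fun y _ => ?_
  rw [circ_apply]
  exact Finset.sum_congr rfl fun i _ => insertArgs_faceVal F G φ _ l _ i m rfl

theorem act_eq_faceVal {N p q : ℕ} (φ : Nerve C N) (ζ : Fin (p + 1) →o Fin (N + 1))
    (hζ : StrictMono ζ) {S : Finset (Fin (N + 1))} (hS : ∀ x, x ∈ S ↔ ∃ j, ζ j = x)
    (a : Fin q → 𝒜.obj (φ.vertex (Fin.last N))) :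
    act ζ (F p q) φ a = faceVal F φ S 0 (Fin.last N) (List.ofFn a) :=
  (faceVal_eq_evalOn F φ ζ hζ hS (Fin.zero_le _) (Fin.le_last _) a rfl).symm

theorem ofFn_take {U : Type*} (l : List U) (n : ℕ) (h : n ≤ l.length) :
    List.ofFn (fun j : Fin n => l.get ⟨j.1, by omega⟩) = l.take n := by
  have := ofFn_getElem_drop_take l 0 n (by omega)
  simpa using this

theorem ofFn_drop {U : Type*} (l : List U) (i n : ℕ) (h : i + n = l.length) :
    List.ofFn (fun j : Fin n => l.get ⟨i + j.1, by omega⟩) = l.drop i := by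
  rw [← List.take_length (l := l.drop i), List.length_drop,
    ← ofFn_getElem_drop_take _ _ _ (by omega)]
  obtain rfl : n = l.length - i := by omega
  rfl

theorem faceVal_cup_univ {N : ℕ} (φ : Nerve C N) (l : List (𝒜.obj (φ.vertex (Fin.last N)))) :
    faceVal (cup F G) φ Finset.univ 0 (Fin.last N) l =
      ∑ m, splitSum (fun u v => faceVal F φ (Finset.Iic m) 0 (Fin.last N) u *
        faceVal G φ (Finset.Ici m) 0 (Fin.last N) v) l := by
  rw [faceVal_univ]
  simp only [cup, sum_apply]
  rw [sum_antidiagonal_eq_sum_fin]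
  refine Finset.sum_congr rfl fun m _ => ?_
  rw [splitSum_eq_sum_antidiagonal]
  refine Finset.sum_congr rfl fun y _ => ?_
  have hy := Finset.HasAntidiagonal.mem_antidiagonal.mp y.2
  refine congrArg₂ (fun a b : 𝒜.obj (φ.vertex 0) => a * b) ?_ ?_
  · rw [act_eq_faceVal F φ _ (fun _ _ h => h) (S := Finset.Iic m), ofFn_take l _ (by omega)]
    intro x
    rw [Finset.mem_Iic]
    constructor
    · intro h
      exact ⟨⟨x.1, Nat.lt_succ_of_le h⟩, rfl⟩
    · rintro ⟨j, rfl⟩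
      exact Nat.le_of_lt_succ j.2
  · rw [act_eq_faceVal G φ _ (fun _ _ h => Nat.add_lt_add_left h _) (S := Finset.Ici m),
      ofFn_drop l _ _ (by omega)]
    intro x
    rw [Finset.mem_Ici]
    constructor
    · intro h
      have h' : m.1 ≤ x.1 := h
      exact ⟨⟨x.1 - m.1, by dsimp only; omega⟩, Fin.ext (Nat.add_sub_cancel' h')⟩
    · rintro ⟨j, rfl⟩
      exact Nat.le_add_right m.1 j

end Expansion

section Expansion

variable {𝕜 : Type u} [Field 𝕜] {C : Type v₁} [Category.{v₂} C]
  {𝒜 : C ⥤ NonUnitalAlgCat.{u, w} 𝕜}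
variable (F G : BiCochain 𝒜)

theorem splitSum_eq_sum_antidiagonal_swap {B M : Type*} [AddCommMonoid M]
    (Φ : List B → List B → M) (l : List B) :
    splitSum Φ l = ∑ y : Finset.HasAntidiagonal.antidiagonal l.length,
      Φ (l.take y.1.2) (l.drop y.1.2) := by
  rw [splitSum_eq_sum_antidiagonal,
    Finset.sum_coe_sort (Finset.HasAntidiagonal.antidiagonal l.length)
      (fun y => Φ (l.take y.1) (l.drop y.1)),
    Finset.sum_coe_sort (Finset.HasAntidiagonal.antidiagonal l.length)
      (fun y => Φ (l.take y.2) (l.drop y.2))]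
  exact Finset.Nat.sum_antidiagonal_swap (f := fun y => Φ (l.take y.2) (l.drop y.2))

theorem sum_Ioi_eq_sum_range {M : Type*} [AddCommMonoid M] {N : ℕ} (c : Fin (N + 1))
    (Z : ℕ → M) :
    ∑ d ∈ Finset.Ioi c, Z (d.1 - c.1) = ∑ j ∈ Finset.range (N - c), Z (j + 1) := by
  refine Finset.sum_bij' (fun d _ => d.1 - c.1 - 1) (fun j hj => ⟨c.1 + j + 1, ?_⟩) ?_ ?_ ?_ ?_ ?_
  · have := Finset.mem_range.mp hj
    omega
  · intro d hd
    have : c.1 < d.1 := Fin.lt_def.mp (Finset.mem_Ioi.mp hd)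
    rw [Finset.mem_range]
    omega
  · intro j hj
    rw [Finset.mem_Ioi, Fin.lt_def]
    dsimp only
    omega
  · intro d hd
    have : c.1 < d.1 := Fin.lt_def.mp (Finset.mem_Ioi.mp hd)
    ext
    dsimp only
    omega
  · intro j hj
    dsimp only
    omega
  · intro d hd
    have : c.1 < d.1 := Fin.lt_def.mp (Finset.mem_Ioi.mp hd)
    congr 1
    omega

theorem mem_Icc_iff_inner {N p₁ p₂ : ℕ} (hp : p₁ + p₂ = N + 1) (c : Fin p₁) (d e : Fin (N + 1))
    (hd : d.1 = c.1) (he : e.1 = c.1 + p₂) (x : Fin (N + 1)) :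
    x ∈ Finset.Icc d e ↔ ∃ j, inner hp c j = x := by
  rw [Finset.mem_Icc, Fin.le_def, Fin.le_def]
  constructor
  · intro h
    exact ⟨⟨x.1 - c.1, by omega⟩, Fin.ext (Nat.add_sub_cancel' (by omega))⟩
  · rintro ⟨j, rfl⟩
    have : (inner hp c j).1 = c.1 + j.1 := rfl
    omega

theorem outer_val {N p₁ p₂ : ℕ} (hp : p₁ + p₂ = N + 1) (c : Fin p₁) (h₂ : 1 ≤ p₂)
    (j : Fin (p₁ + 1)) : (outer hp c h₂ j).1 = if j.1 ≤ c.1 then j.1 else j.1 + p₂ - 1 := by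
  change (if j.1 ≤ c.1 then (⟨j.1, _⟩ : Fin (N + 1)) else ⟨j.1 + p₂ - 1, _⟩).1 = _
  split_ifs <;> rfl

theorem strictMono_outer {N p₁ p₂ : ℕ} (hp : p₁ + p₂ = N + 1) (c : Fin p₁) (h₂ : 1 ≤ p₂) :
    StrictMono (outer hp c h₂) := by
  intro i j h
  rw [Fin.lt_def] at h ⊢
  rw [outer_val, outer_val]
  split_ifs <;> omega

theorem mem_compl_Ioo_iff_outer {N p₁ p₂ : ℕ} (hp : p₁ + p₂ = N + 1) (c : Fin p₁) (h₂ : 1 ≤ p₂)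
    (d e : Fin (N + 1)) (hd : d.1 = c.1) (he : e.1 = c.1 + p₂) (x : Fin (N + 1)) :
    x ∈ Finset.univ \ Finset.Ioo d e ↔ ∃ j, outer hp c h₂ j = x := by
  simp only [Finset.mem_sdiff, Finset.mem_univ, true_and, Finset.mem_Ioo, Fin.lt_def, Fin.ext_iff,
    outer_val]
  constructor
  · intro h
    by_cases hx : x.1 ≤ c.1
    · exact ⟨⟨x.1, by omega⟩, if_pos hx⟩
    · refine ⟨⟨x.1 + 1 - p₂, by omega⟩, ?_⟩
      dsimp only
      rw [if_neg (by omega)]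
      omega
  · rintro ⟨j, hj⟩
    split_ifs at hj <;> omega

/-- In `f • g` the cochain `g` occupies the interval `[c, d]` of vertices, and `f` the vertices
outside its interior. -/
theorem faceVal_bulletTotal_univ [CharP 𝕜 2] {N : ℕ} (φ : Nerve C N)
    (l : List (𝒜.obj (φ.vertex (Fin.last N)))) :
    faceVal (bulletTotal F G) φ Finset.univ 0 (Fin.last N) l =
      ∑ c, ∑ d ∈ Finset.Ioi c, splitSum (fun u v =>
        faceVal G φ (Finset.Icc c d) 0 (Fin.last N) u *
          faceVal F φ (Finset.univ \ Finset.Ioo c d) 0 (Fin.last N) v) l := by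
  -- `Z c k` is the contribution of the pair of vertices `c` and `c + k`.
  let Z : ℕ → ℕ → 𝒜.obj (φ.vertex 0) := fun c k => if h : c + k ≤ N ∧ 1 ≤ k then
    splitSum (fun u v =>
        faceVal G φ (Finset.Icc ⟨c, by omega⟩ ⟨c + k, by omega⟩) 0 (Fin.last N) u *
          faceVal F φ (Finset.univ \ Finset.Ioo ⟨c, by omega⟩ ⟨c + k, by omega⟩) 0
            (Fin.last N) v) l else 0
  have hR : ∀ c : Fin (N + 1), ∑ d ∈ Finset.Ioi c, splitSum (fun u v =>
        faceVal G φ (Finset.Icc c d) 0 (Fin.last N) u *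
          faceVal F φ (Finset.univ \ Finset.Ioo c d) 0 (Fin.last N) v) l =
        ∑ j ∈ Finset.range (N - c + 1), Z c j := by
    intro c
    rw [Finset.sum_range_succ', ← sum_Ioi_eq_sum_range]
    have hZ : Z c 0 = 0 := dif_neg (by omega)
    rw [hZ, add_zero]
    refine Finset.sum_congr rfl fun d hd => ?_
    have hcd : c.1 < d.1 := Fin.lt_def.mp (Finset.mem_Ioi.mp hd)
    have hd' : d = ⟨c.1 + (d.1 - c.1), by omega⟩ := Fin.ext (by dsimp only; omega)
    simp only [Z]
    rw [dif_pos (by omega)]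
    simp only [← hd']
  rw [Finset.sum_congr rfl fun c _ => hR c,
    ← Finset.sum_range fun c => ∑ j ∈ Finset.range (N - c + 1), Z c j,
    ← sum_antidiagonal_succ_sum_fin, faceVal_univ]
  simp only [bulletTotal, Finset.sum_apply, sum_apply]
  refine Finset.sum_congr rfl fun x _ => ?_
  obtain ⟨⟨p₁, p₂⟩, hx⟩ := x
  have hp := Finset.HasAntidiagonal.mem_antidiagonal.mp hx
  dsimp only at hp ⊢
  by_cases h₂ : 1 ≤ p₂
  · simp only [bullet_apply _ _ _ _ h₂]
    rw [Finset.sum_comm]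
    refine Finset.sum_congr rfl fun c _ => ?_
    have hc := c.2
    rw [show Z c p₂ = _ from dif_pos (by omega), splitSum_eq_sum_antidiagonal_swap]
    refine Finset.sum_congr rfl fun y _ => ?_
    have hy := Finset.HasAntidiagonal.mem_antidiagonal.mp y.2
    refine congrArg₂ (fun a b : 𝒜.obj (φ.vertex 0) => a * b) ?_ ?_
    · rw [act_eq_faceVal G φ _ (fun _ _ h => Nat.add_lt_add_left h _)
        (mem_Icc_iff_inner hp c ⟨c, by omega⟩ ⟨c + p₂, by omega⟩ rfl rfl),
        ofFn_take l _ (by omega)]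
    · rw [act_eq_faceVal F φ _ (strictMono_outer hp c h₂)
        (mem_compl_Ioo_iff_outer hp c h₂ ⟨c, by omega⟩ ⟨c + p₂, by omega⟩ rfl rfl),
        ofFn_drop l _ _ (by omega)]
  · have hZ : ∀ c, Z c p₂ = 0 := fun c => dif_neg (by omega)
    simp only [hZ, Finset.sum_const_zero]
    refine Finset.sum_eq_zero fun y _ => ?_
    rw [bullet, dif_neg h₂]
    rfl

theorem mem_erase_iff_succAbove {N : ℕ} (i x : Fin (N + 2)) :
    x ∈ Finset.univ.erase i ↔ ∃ j, (Fin.succAboveOrderEmb i).toOrderHom j = x := by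
  rw [Finset.mem_erase]
  exact ⟨fun h => Fin.exists_succAbove_eq h.1, by
    rintro ⟨j, rfl⟩; exact ⟨Fin.succAbove_ne i j, Finset.mem_univ _⟩⟩

theorem deltaS_eq_sum_faceVal [CharP 𝕜 2] {N q : ℕ} (φ : Nerve C (N + 1))
    (a : Fin q → 𝒜.obj (φ.vertex (Fin.last (N + 1)))) :
    deltaS (F N q) φ a =
      ∑ x, faceVal F φ (Finset.univ.erase x) 0 (Fin.last (N + 1)) (List.ofFn a) := by
  rw [deltaS_apply]
  exact Finset.sum_congr rfl fun i _ => act_eq_faceVal F φ _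
    (Fin.succAboveOrderEmb i).strictMono (mem_erase_iff_succAbove i) a

section Binary

variable {U W : Type w} {q₂ q : ℕ} (hq : 2 + q₂ = q + 1) (G : (Fin q₂ → U) → W) (t : U → W)
  (a : Fin q → U)

theorem insertArgs_zero_zero :
    insertArgs hq 0 G t a 0 = G fun j => a ⟨0 + j.1, by omega⟩ := by
  simp [insertArgs]

theorem insertArgs_zero_one : insertArgs hq 0 G t a 1 = t (a ⟨q₂, by omega⟩) := by
  simp [insertArgs]

theorem insertArgs_one_zero : insertArgs hq 1 G t a 0 = t (a ⟨0, by omega⟩) := by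
  simp [insertArgs]

theorem insertArgs_one_one :
    insertArgs hq 1 G t a 1 = G fun j => a ⟨1 + j.1, by omega⟩ := by
  simp [insertArgs]

end Binary

/-- The multiplication composed with `F` gives the two outer terms of the Hochschild coboundary. -/
theorem circ_mulCochain_left [CharP 𝕜 2] {N : ℕ} (φ : Nerve C N)
    (x : 𝒜.obj (φ.vertex (Fin.last N))) (l : List (𝒜.obj (φ.vertex (Fin.last N))))
    (hp : 0 + N = N) (hq : 2 + l.length = (l.length + 1) + 1) :
    circ hp hq (mulCochain 𝒜) (F N l.length) φ (x :: l).get =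
      leadTerm (transport 𝒜 φ (Fin.zero_le _)) (faceVal F φ Finset.univ 0 (Fin.last N)) (x :: l) +
      trailTerm (transport 𝒜 φ (Fin.zero_le _)) (faceVal F φ Finset.univ 0 (Fin.last N))
        (x :: l) := by
  have hF : ∀ b : Fin l.length → 𝒜.obj (φ.vertex (Fin.last N)),
      faceVal F φ Finset.univ 0 (Fin.last N) (List.ofFn b) =
        transport 𝒜 φ (Fin.zero_le _) (F N l.length (φ.pull (back hp)) fun l =>
            transport 𝒜 φ (Fin.le_last (back hp (Fin.last N))) (b l)) := fun b => by
    refine faceVal_eq_evalOn F φ (back hp) ?_ ?_ _ _ b rfl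
    · intro x y h
      exact Nat.add_lt_add_left h 0
    · intro x
      exact iff_of_true (Finset.mem_univ x) ⟨x, Fin.ext (Nat.zero_add x.1)⟩
  have hmul : ∀ b, transport 𝒜 φ (Fin.zero_le (front hp 0)) (mulCochain 𝒜 (φ.pull (front hp)) b) =
      transport 𝒜 φ (Fin.zero_le (front hp (Fin.last 0))) (b 0) *
        transport 𝒜 φ (Fin.zero_le (front hp (Fin.last 0))) (b 1) := fun b =>
    (transport_trans φ _ _ (b 0 * b 1)).trans (transport_mul φ _ _ _)
  have hlast : (x :: l).get ⟨l.length, by simp⟩ = (x :: l).getLast (by simp) := by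
    simp [List.getLast_eq_getElem]
  have hinit := ofFn_getElem_drop_take (x :: l) 0 l.length (by simp)
  have htail := ofFn_getElem_drop_take (x :: l) 1 l.length (by simp; omega)
  rw [List.drop_zero, show (x :: l).take l.length = (x :: l).dropLast by
    rw [List.dropLast_eq_take, List.length_cons, Nat.add_sub_cancel]] at hinit
  rw [List.drop_one, List.tail_cons, List.take_length] at htail
  have hL := congrArg (transport 𝒜 φ (Fin.zero_le _) x * ·) ((hF _).symm.trans
    (congrArg (faceVal F φ Finset.univ 0 (Fin.last N)) htail))
  have hT := congrArg₂ (fun a b : 𝒜.obj (φ.vertex 0) => a * b) ((hF _).symm.trans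
    (congrArg (faceVal F φ Finset.univ 0 (Fin.last N)) hinit))
    (congrArg (transport 𝒜 φ (Fin.zero_le (Fin.last N))) hlast)
  rw [circ_apply, Fin.sum_univ_two, trailTerm_cons]
  refine Eq.trans ?_ ((add_comm _ _).trans
    (congrArg₂ (fun a b : 𝒜.obj (φ.vertex 0) => a + b) hL hT))
  refine congrArg₂ (fun a b : 𝒜.obj (φ.vertex 0) => a + b) ((hmul _).trans ?_)
    ((hmul _).trans ?_)
  · refine congrArg₂ (fun a b : 𝒜.obj (φ.vertex 0) => a * b) ?_ ?_
    · exact (congrArg (transport 𝒜 φ _) (insertArgs_zero_zero hq _ _ _)).trans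
        (transport_trans φ _ _ _)
    · exact (congrArg (transport 𝒜 φ _) (insertArgs_zero_one hq _ _ _)).trans
        (transport_trans φ _ _ _)
  · refine congrArg₂ (fun a b : 𝒜.obj (φ.vertex 0) => a * b) ?_ ?_
    · exact (congrArg (transport 𝒜 φ _) (insertArgs_one_zero hq _ _ _)).trans
        (transport_trans φ _ _ _)
    · exact (congrArg (transport 𝒜 φ _) (insertArgs_one_one hq _ _ _)).trans
        (transport_trans φ _ _ _)

/-- `F` composed with the multiplication gives the inner terms of the Hochschild coboundary. -/
theorem circ_mulCochain_right [CharP 𝕜 2] {N : ℕ} (φ : Nerve C N)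
    (x : 𝒜.obj (φ.vertex (Fin.last N))) (l : List (𝒜.obj (φ.vertex (Fin.last N))))
    (hp : N + 0 = N) (hq : l.length + 2 = (l.length + 1) + 1) :
    circ hp hq (F N l.length) (mulCochain 𝒜) φ (x :: l).get =
      mergeSum (faceVal F φ Finset.univ 0 (Fin.last N)) (x :: l) := by
  rw [circ_apply, mergeSum_eq_sum]
  refine Finset.sum_congr rfl fun i _ => ?_
  have hi := i.2
  have hS : ∀ x, x ∈ Finset.univ ↔ ∃ j, front hp j = x := fun x =>
    iff_of_true (Finset.mem_univ x) ⟨x, rfl⟩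
  have hlist := ofFn_insertArgs (x :: l) hq i
    (fun b : Fin 2 → 𝒜.obj (φ.vertex (Fin.last N)) => b 0 * b 1) id
  rw [List.map_id, List.map_id] at hlist
  refine Eq.trans ?_ (faceVal_eq_evalOn F φ (front hp) (fun _ _ h => h) hS (Fin.zero_le _)
    (le_refl (Fin.last N)) _ hlist.symm).symm
  unfold evalOn
  congr 2
  funext j
  refine Eq.trans ?_ (transport_refl φ (Fin.last N) _ _).symm
  congr 1
  · funext b
    refine (transport_refl φ (Fin.last N) _ _).trans ((transport_refl φ (Fin.last N) _ _).trans ?_)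
    exact congrArg₂ (fun a b : 𝒜.obj (φ.vertex (Fin.last N)) => a * b)
      (transport_refl φ (Fin.last N) _ _) (transport_refl φ (Fin.last N) _ _)
  · funext b
    exact transport_refl φ (Fin.last N) _ _

theorem faceVal_delta_univ [CharP 𝕜 2] {N : ℕ} (φ : Nerve C N)
    (l : List (𝒜.obj (φ.vertex (Fin.last N)))) :
    faceVal (delta 𝒜 F) φ Finset.univ 0 (Fin.last N) l =
      ∑ x, faceVal F φ (Finset.univ.erase x) 0 (Fin.last N) l +
        wordDelta (transport 𝒜 φ (Fin.zero_le _)) (faceVal F φ Finset.univ 0 (Fin.last N)) l := by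
  rw [faceVal_univ]
  refine congrArg₂ (fun a b : 𝒜.obj (φ.vertex 0) => a + b) ?_ ?_
  · cases N with
    | zero => simp [faceVal_empty]
    | succ N =>
      refine (deltaS_eq_sum_faceVal F φ l.get).trans ?_
      rw [List.ofFn_get]
  · cases l with
    | nil => simp [wordDelta, leadTerm, mergeSum, trailTerm]
    | cons x l =>
      change deltaH (F N l.length) φ (x :: l).get = _
      have h := circ_mulCochain_left F φ x l (Nat.zero_add N) (by omega)
      have h' := circ_mulCochain_right F φ x l (Nat.add_zero N) (by omega)
      rw [wordDelta, deltaH, neg_one_pow_eq_one_of_charTwo, one_smul]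
      refine (congrArg₂ (fun a b : 𝒜.obj (φ.vertex 0) => a - b) h h').trans ?_
      linear_combination (norm := abel) -add_self_eq_zero_of_charTwo 𝕜
        (mergeSum (faceVal F φ Finset.univ 0 (Fin.last N)) (x :: l))

end Expansion

/-! ### The operations on the faces of a simplex -/

section Faces

variable {𝕜 : Type u} [Field 𝕜] {C : Type v₁} [Category.{v₂} C]
  {𝒜 : C ⥤ NonUnitalAlgCat.{u, w} 𝕜}
variable (F G : BiCochain 𝒜)

/-- The faces of a face of `φ` are faces of `φ`. -/
theorem faceVal_pull {N p : ℕ} (φ : Nerve C N) (ζ : Fin (p + 1) →o Fin (N + 1))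
    (hζ : StrictMono ζ) {T : Finset (Fin (p + 1))} {S : Finset (Fin (N + 1))}
    (hS : ∀ x, x ∈ S ↔ ∃ j ∈ T, ζ j = x) (i k : Fin (p + 1))
    (l : List (𝒜.obj (φ.vertex (ζ k)))) :
    faceVal F (φ.pull ζ) T i k l = faceVal F φ S (ζ i) (ζ k) l := by
  by_cases hc : T.Nonempty ∧ ∀ x ∈ T, i ≤ x ∧ x ≤ k
  · obtain ⟨r, ξ, hξ, hξT⟩ := exists_face hc.1
    have hb := fun j => hc.2 (ξ j) ((hξT _).mpr ⟨_, rfl⟩)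
    have hcomp : ∀ x, x ∈ S ↔ ∃ j, (ζ.comp ξ) j = x := fun x => by
      rw [hS]
      constructor
      · rintro ⟨j, hj, rfl⟩
        obtain ⟨j, rfl⟩ := (hξT j).mp hj
        exact ⟨j, rfl⟩
      · rintro ⟨j, rfl⟩
        exact ⟨ξ j, (hξT _).mpr ⟨j, rfl⟩, rfl⟩
    rw [faceVal_eq_evalOn F φ (ζ.comp ξ) (hζ.comp hξ) hcomp (ζ.monotone (hb 0).1)
      (ζ.monotone (hb (Fin.last r)).2) l.get (List.ofFn_get l).symm]
    exact faceVal_eq_evalOn F (φ.pull ζ) ξ hξ hξT (hb 0).1 (hb (Fin.last r)).2 l.get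
      (List.ofFn_get l).symm
  · have hc' : ¬ (S.Nonempty ∧ ∀ x ∈ S, ζ i ≤ x ∧ x ≤ ζ k) := by
      rintro ⟨⟨x, hx⟩, h⟩
      obtain ⟨j, hj, -⟩ := (hS x).mp hx
      refine hc ⟨⟨j, hj⟩, fun y hy => ?_⟩
      have := h (ζ y) ((hS _).mpr ⟨y, hy, rfl⟩)
      exact ⟨hζ.le_iff_le.mp this.1, hζ.le_iff_le.mp this.2⟩
    exact Eq.trans (dif_neg hc) (Eq.symm (dif_neg hc'))

theorem transport_faceVal_pull {N p : ℕ} (φ : Nerve C N) (ζ : Fin (p + 1) →o Fin (N + 1))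
    (hζ : StrictMono ζ) {T : Finset (Fin (p + 1))} {S : Finset (Fin (N + 1))}
    (hS : ∀ x, x ∈ S ↔ ∃ j ∈ T, ζ j = x) {s e : Fin (N + 1)} (hs : s ≤ ζ 0)
    (he : ζ (Fin.last p) ≤ e) (l : List (𝒜.obj (φ.vertex e))) :
    transport 𝒜 φ hs (faceVal F (φ.pull ζ) T 0 (Fin.last p) (l.map (transport 𝒜 φ he))) =
      faceVal F φ S s e l := by
  have h : ∀ x ∈ S, ζ 0 ≤ x ∧ x ≤ ζ (Fin.last p) := fun x hx => by
    obtain ⟨j, -, rfl⟩ := (hS x).mp hx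
    exact ⟨ζ.monotone (Fin.zero_le j), ζ.monotone (Fin.le_last j)⟩
  rw [← faceVal_map_transport F φ he (fun x hx => (h x hx).2),
    ← transport_faceVal F φ hs (fun x hx => (h x hx).1)]
  exact congrArg _ (faceVal_pull F φ ζ hζ hS 0 (Fin.last p) _)

theorem sum_face_eq_sum_univ {M : Type*} [AddCommMonoid M] {N p : ℕ}
    {ζ : Fin (p + 1) →o Fin (N + 1)} (hζ : StrictMono ζ) {S : Finset (Fin (N + 1))}
    (hS : ∀ x, x ∈ S ↔ ∃ j, ζ j = x) (P : Fin (N + 1) → Prop) [DecidablePred P]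
    (h : Fin (N + 1) → M) : ∑ x ∈ S with P x, h x = ∑ j with P (ζ j), h (ζ j) := by
  have : S = Finset.univ.map ⟨ζ, hζ.injective⟩ := by ext x; simp [hS]
  rw [this, Finset.filter_map, Finset.sum_map]
  rfl

theorem mem_erase_face {N p : ℕ} {ζ : Fin (p + 1) →o Fin (N + 1)} (hζ : StrictMono ζ)
    {S : Finset (Fin (N + 1))} (hS : ∀ x, x ∈ S ↔ ∃ j, ζ j = x) (j : Fin (p + 1))
    (x : Fin (N + 1)) : x ∈ S.erase (ζ j) ↔ ∃ i ∈ Finset.univ.erase j, ζ i = x := by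
  simp only [Finset.mem_erase, hS, Finset.mem_univ, and_true]
  constructor
  · rintro ⟨h, i, rfl⟩
    exact ⟨i, fun h' => h (congrArg ζ h'), rfl⟩
  · rintro ⟨i, h, rfl⟩
    exact ⟨fun h' => h (hζ.injective h'), i, rfl⟩

theorem mem_filter_face {N p : ℕ} {ζ : Fin (p + 1) →o Fin (N + 1)}
    {S : Finset (Fin (N + 1))} (hS : ∀ x, x ∈ S ↔ ∃ j, ζ j = x) (P : Fin (N + 1) → Prop)
    [DecidablePred P] {T : Finset (Fin (p + 1))} (hT : ∀ i, i ∈ T ↔ P (ζ i)) (x : Fin (N + 1)) :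
    x ∈ S.filter P ↔ ∃ i ∈ T, ζ i = x := by
  simp only [Finset.mem_filter, hS, hT]
  constructor
  · rintro ⟨⟨i, rfl⟩, h⟩
    exact ⟨i, h, rfl⟩
  · rintro ⟨i, h, rfl⟩
    exact ⟨⟨i, rfl⟩, h⟩

/-- The coboundary on a face, as the sum over the vertices of the face and the Hochschild
coboundary of the value on the face. -/
theorem faceVal_delta [CharP 𝕜 2] {N : ℕ} (φ : Nerve C N) {S : Finset (Fin (N + 1))}
    {s e : Fin (N + 1)} (hse : s ≤ e) (hb : ∀ x ∈ S, s ≤ x ∧ x ≤ e)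
    (l : List (𝒜.obj (φ.vertex e))) :
    faceVal (delta 𝒜 F) φ S s e l = ∑ x ∈ S, faceVal F φ (S.erase x) s e l +
      wordDelta (transport 𝒜 φ hse) (faceVal F φ S s e) l := by
  rcases S.eq_empty_or_nonempty with rfl | hne
  · have : faceVal F φ ∅ s e = fun _ => 0 := funext fun z => faceVal_empty F φ s e z
    rw [this, wordDelta_zero, faceVal_empty, Finset.sum_empty, add_zero]
  obtain ⟨p, ζ, hζ, hS⟩ := exists_face hne
  have hs : s ≤ ζ 0 := (hb _ ((hS _).mpr ⟨_, rfl⟩)).1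
  have he : ζ (Fin.last p) ≤ e := (hb _ ((hS _).mpr ⟨_, rfl⟩)).2
  have hU : ∀ x, x ∈ S ↔ ∃ j ∈ Finset.univ, ζ j = x := fun x => by simp [hS]
  rw [← transport_faceVal_pull (delta 𝒜 F) φ ζ hζ hU hs he, faceVal_delta_univ]
  refine ((transport 𝒜 φ hs).map_add _ _).trans
    (congrArg₂ (fun a b : 𝒜.obj (φ.vertex s) => a + b)
      ((map_sum (transport 𝒜 φ hs) _ _).trans ?_) ?_)
  · have := sum_face_eq_sum_univ hζ hS (fun _ => True) fun x => faceVal F φ (S.erase x) s e l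
    simp only [Finset.filter_true] at this
    rw [this]
    exact Finset.sum_congr rfl fun j _ =>
      transport_faceVal_pull F φ ζ hζ (mem_erase_face hζ hS j) hs he l
  · refine (map_wordDelta (transport 𝒜 φ hs).toAddMonoidHom (transport_mul φ hs)
      (transport 𝒜 φ he) (transport_mul φ he) _ _ l).trans ?_
    congr 1
    · funext b
      exact (congrArg _ (transport_trans φ (ζ.monotone (Fin.zero_le (Fin.last p))) he b)).trans
        (transport_trans φ hs _ b)
    · funext z
      exact transport_faceVal_pull F φ ζ hζ hU hs he z

theorem faceVal_circTotal [CharP 𝕜 2] {N : ℕ} (φ : Nerve C N) (S : Finset (Fin (N + 1)))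
    (l : List (𝒜.obj (φ.vertex (Fin.last N)))) :
    faceVal (circTotal F G) φ S 0 (Fin.last N) l =
      ∑ m ∈ S, insertSum (transport 𝒜 φ (Fin.le_last m))
        (faceVal G φ (S.filter (m ≤ ·)) m (Fin.last N))
        (faceVal F φ (S.filter (· ≤ m)) 0 m) l := by
  rcases S.eq_empty_or_nonempty with rfl | hne
  · rw [faceVal_empty, Finset.sum_empty]
  obtain ⟨p, ζ, hζ, hS⟩ := exists_face hne
  have hU : ∀ x, x ∈ S ↔ ∃ j ∈ Finset.univ, ζ j = x := fun x => by simp [hS]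
  rw [← transport_faceVal_pull (circTotal F G) φ ζ hζ hU (Fin.zero_le _) (Fin.le_last _),
    faceVal_circTotal_univ]
  refine (map_sum (transport 𝒜 φ (Fin.zero_le (ζ 0))) _ _).trans ?_
  have := sum_face_eq_sum_univ hζ hS (fun _ => True) fun m =>
    insertSum (transport 𝒜 φ (Fin.le_last m)) (faceVal G φ (S.filter (m ≤ ·)) m (Fin.last N))
      (faceVal F φ (S.filter (· ≤ m)) 0 m) l
  simp only [Finset.filter_true] at this
  rw [this]
  refine Finset.sum_congr rfl fun j _ => ?_
  refine (map_insertSum (transport 𝒜 φ (Fin.zero_le (ζ 0))).toAddMonoidHom _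
    (transport 𝒜 φ (Fin.le_last (ζ (Fin.last p)))) _ _ l).trans ?_
  congr 1
  · funext b
    exact transport_trans φ (ζ.monotone (Fin.le_last j)) _ b
  · funext z
    have h := mem_filter_face hS (ζ j ≤ ·) (T := Finset.Ici j) fun i => by
      rw [Finset.mem_Ici, hζ.le_iff_le]
    rw [← faceVal_map_transport G φ (Fin.le_last (ζ (Fin.last p)))]
    · exact faceVal_pull G φ ζ hζ h j (Fin.last p) _
    · intro x hx
      obtain ⟨i, -, rfl⟩ := (h x).mp hx
      exact ζ.monotone (Fin.le_last i)
  · funext z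
    have h := mem_filter_face hS (· ≤ ζ j) (T := Finset.Iic j) fun i => by
      rw [Finset.mem_Iic, hζ.le_iff_le]
    refine Eq.trans (congrArg (transport 𝒜 φ _) (faceVal_pull F φ ζ hζ h 0 j z))
      (transport_faceVal F φ (Fin.zero_le (ζ 0)) (fun x hx => ?_) (ζ j) z)
    obtain ⟨i, -, rfl⟩ := (h x).mp hx
    exact ζ.monotone (Fin.zero_le i)

theorem transport_splitSum_mul {N p : ℕ} (φ : Nerve C N) (ζ : Fin (p + 1) →o Fin (N + 1))
    (hζ : StrictMono ζ) {T T' : Finset (Fin (p + 1))} {S S' : Finset (Fin (N + 1))}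
    (hS : ∀ x, x ∈ S ↔ ∃ j ∈ T, ζ j = x) (hS' : ∀ x, x ∈ S' ↔ ∃ j ∈ T', ζ j = x)
    (l : List (𝒜.obj (φ.vertex (Fin.last N)))) :
    transport 𝒜 φ (Fin.zero_le (ζ 0)) (splitSum
      (fun u v => faceVal F (φ.pull ζ) T 0 (Fin.last p) u *
        faceVal G (φ.pull ζ) T' 0 (Fin.last p) v)
      (l.map (transport 𝒜 φ (Fin.le_last (ζ (Fin.last p)))))) =
      splitSum (fun u v => faceVal F φ S 0 (Fin.last N) u * faceVal G φ S' 0 (Fin.last N) v) l := by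
  refine (map_splitSum (transport 𝒜 φ (Fin.zero_le (ζ 0))).toAddMonoidHom _ _).trans ?_
  refine (splitSum_map _ _ _).trans ?_
  congr 1
  funext u v
  rw [← transport_faceVal_pull F φ ζ hζ hS (Fin.zero_le _) (Fin.le_last _),
    ← transport_faceVal_pull G φ ζ hζ hS' (Fin.zero_le _) (Fin.le_last _)]
  exact transport_mul φ _ _ _

theorem faceVal_cup {N : ℕ} (φ : Nerve C N) (S : Finset (Fin (N + 1)))
    (l : List (𝒜.obj (φ.vertex (Fin.last N)))) :
    faceVal (cup F G) φ S 0 (Fin.last N) l =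
      ∑ m ∈ S, splitSum (fun u v => faceVal F φ (S.filter (· ≤ m)) 0 (Fin.last N) u *
        faceVal G φ (S.filter (m ≤ ·)) 0 (Fin.last N) v) l := by
  rcases S.eq_empty_or_nonempty with rfl | hne
  · rw [faceVal_empty, Finset.sum_empty]
  obtain ⟨p, ζ, hζ, hS⟩ := exists_face hne
  have hU : ∀ x, x ∈ S ↔ ∃ j ∈ Finset.univ, ζ j = x := fun x => by simp [hS]
  rw [← transport_faceVal_pull (cup F G) φ ζ hζ hU (Fin.zero_le _) (Fin.le_last _),
    faceVal_cup_univ]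
  refine (map_sum (transport 𝒜 φ (Fin.zero_le (ζ 0))) _ _).trans ?_
  have := sum_face_eq_sum_univ hζ hS (fun _ => True) fun m =>
    splitSum (fun u v => faceVal F φ (S.filter (· ≤ m)) 0 (Fin.last N) u *
        faceVal G φ (S.filter (m ≤ ·)) 0 (Fin.last N) v) l
  simp only [Finset.filter_true] at this
  rw [this]
  exact Finset.sum_congr rfl fun j _ => transport_splitSum_mul F G φ ζ hζ
    (mem_filter_face hS (· ≤ ζ j) fun i => by rw [Finset.mem_Iic, hζ.le_iff_le])
    (mem_filter_face hS (ζ j ≤ ·) fun i => by rw [Finset.mem_Ici, hζ.le_iff_le]) l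

theorem faceVal_bulletTotal [CharP 𝕜 2] {N : ℕ} (φ : Nerve C N) (S : Finset (Fin (N + 1)))
    (l : List (𝒜.obj (φ.vertex (Fin.last N)))) :
    faceVal (bulletTotal F G) φ S 0 (Fin.last N) l =
      ∑ c ∈ S, ∑ d ∈ S with c < d, splitSum (fun u v =>
        faceVal G φ (S.filter fun x => c ≤ x ∧ x ≤ d) 0 (Fin.last N) u *
          faceVal F φ (S.filter fun x => ¬ (c < x ∧ x < d)) 0 (Fin.last N) v) l := by
  rcases S.eq_empty_or_nonempty with rfl | hne
  · rw [faceVal_empty, Finset.sum_empty]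
  obtain ⟨p, ζ, hζ, hS⟩ := exists_face hne
  have hU : ∀ x, x ∈ S ↔ ∃ j ∈ Finset.univ, ζ j = x := fun x => by simp [hS]
  rw [← transport_faceVal_pull (bulletTotal F G) φ ζ hζ hU (Fin.zero_le _) (Fin.le_last _),
    faceVal_bulletTotal_univ]
  refine (map_sum (transport 𝒜 φ (Fin.zero_le (ζ 0))) _ _).trans ?_
  have := sum_face_eq_sum_univ hζ hS (fun _ => True) fun c => ∑ d ∈ S with c < d,
    splitSum (fun u v => faceVal G φ (S.filter fun x => c ≤ x ∧ x ≤ d) 0 (Fin.last N) u *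
          faceVal F φ (S.filter fun x => ¬ (c < x ∧ x < d)) 0 (Fin.last N) v) l
  simp only [Finset.filter_true] at this
  rw [this]
  refine Finset.sum_congr rfl fun c _ => ?_
  rw [sum_face_eq_sum_univ hζ hS (ζ c < ·)]
  refine (map_sum (transport 𝒜 φ (Fin.zero_le (ζ 0))) _ _).trans ?_
  refine Finset.sum_congr (by ext d; simp [hζ.lt_iff_lt]) fun d _ =>
    transport_splitSum_mul G F φ ζ hζ (mem_filter_face hS _ fun i => ?_)
      (mem_filter_face hS _ fun i => ?_) l
  · rw [Finset.mem_Icc, hζ.le_iff_le, hζ.le_iff_le]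
  · rw [Finset.mem_sdiff, Finset.mem_Ioo, hζ.lt_iff_lt, hζ.lt_iff_lt]
    simp

end Faces

/-! ### Sums over the vertices of a simplex -/

section Simplex

variable {M : Type*} [AddCommGroup M] {N : ℕ}

theorem sum_Iio_telescope (h2 : ∀ x : M, x + x = 0) (Z Z' : Fin (N + 1) → M)
    (h : ∀ i : Fin N, Z' i.castSucc = Z i.succ) (d : Fin (N + 1)) :
    ∑ c ∈ Finset.Iio d, (Z' c + Z c) = Z d + Z 0 := by
  induction d using Fin.induction with
  | zero =>
    have : Finset.Iio (0 : Fin (N + 1)) = ∅ := by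
      ext x
      simp
    rw [this, Finset.sum_empty, h2]
  | succ i ih =>
    have : Finset.Iio i.succ = insert i.castSucc (Finset.Iio i.castSucc) := by
      ext x
      simp only [Finset.mem_Iio, Finset.mem_insert, Fin.lt_def, Fin.ext_iff, Fin.val_succ,
        Fin.val_castSucc]
      omega
    rw [this, Finset.sum_insert (by simp), ih, h]
    linear_combination (norm := abel) h2 (Z i.castSucc)

theorem sum_Ioi_telescope (h2 : ∀ x : M, x + x = 0) (Z Z' : Fin (N + 1) → M)
    (h : ∀ i : Fin N, Z' i.succ = Z i.castSucc) (c : Fin (N + 1)) :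
    ∑ d ∈ Finset.Ioi c, (Z' d + Z d) = Z c + Z (Fin.last N) := by
  induction c using Fin.reverseInduction with
  | last =>
    have : Finset.Ioi (Fin.last N) = ∅ := by
      ext x
      simp [Fin.le_last]
    rw [this, Finset.sum_empty, h2]
  | cast i ih =>
    have : Finset.Ioi i.castSucc = insert i.succ (Finset.Ioi i.succ) := by
      ext x
      simp only [Finset.mem_Ioi, Finset.mem_insert, Fin.lt_def, Fin.ext_iff, Fin.val_succ,
        Fin.val_castSucc]
      omega
    rw [this, Finset.sum_insert (by simp), ih, h]
    linear_combination (norm := abel) h2 (Z i.succ)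

theorem sum_erase_eq_sum_Iio_add_sum_Ioi (m : Fin (N + 1)) (f : Fin (N + 1) → M) :
    ∑ x ∈ Finset.univ.erase m, f x = ∑ x ∈ Finset.Iio m, f x + ∑ x ∈ Finset.Ioi m, f x := by
  rw [← Finset.sum_union]
  · congr 1
    ext x
    simp [lt_or_lt_iff_ne]
  · rw [Finset.disjoint_left]
    intro x hx hx'
    exact lt_asymm (Finset.mem_Iio.mp hx) (Finset.mem_Ioi.mp hx')

theorem sum_Iic_eq_sum_Iio_add (m : Fin (N + 1)) (f : Fin (N + 1) → M) :
    ∑ x ∈ Finset.Iic m, f x = ∑ x ∈ Finset.Iio m, f x + f m := by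
  rw [← Finset.Iio_insert, Finset.sum_insert (by simp), add_comm]

theorem sum_Ici_eq_sum_Ioi_add (m : Fin (N + 1)) (f : Fin (N + 1) → M) :
    ∑ x ∈ Finset.Ici m, f x = ∑ x ∈ Finset.Ioi m, f x + f m := by
  rw [← Finset.Ioi_insert, Finset.sum_insert (by simp), add_comm]

/-- The simplicial Leibniz rule for an operation given by cutting a simplex at a vertex `m`. The
terms in which the cut vertex itself is omitted cancel in pairs. -/
theorem sum_erase_cut (h2 : ∀ x : M, x + x = 0)
    (K : Fin (N + 1) → Finset (Fin (N + 1)) → Finset (Fin (N + 1)) → M)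
    (hl : ∀ m T, K m ∅ T = 0) (hr : ∀ m S, K m S ∅ = 0)
    (hK : ∀ i : Fin N, K i.succ (Finset.Iic i.castSucc) (Finset.Ici i.succ) =
      K i.castSucc (Finset.Iic i.castSucc) (Finset.Ici i.succ)) :
    ∑ x, ∑ m ∈ Finset.univ.erase x, K m ((Finset.univ.erase x).filter (· ≤ m))
        ((Finset.univ.erase x).filter (m ≤ ·)) =
      ∑ m, ∑ x ∈ Finset.Iic m, K m ((Finset.Iic m).erase x) (Finset.Ici m) +
        ∑ m, ∑ x ∈ Finset.Ici m, K m (Finset.Iic m) ((Finset.Ici m).erase x) := by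
  have h₁ : ∑ m, K m ((Finset.Iic m).erase m) (Finset.Ici m) =
      ∑ m, K m (Finset.Iic m) ((Finset.Ici m).erase m) := by
    rw [Fin.sum_univ_succ, Fin.sum_univ_castSucc]
    have e₁ : (Finset.Iic (0 : Fin (N + 1))).erase 0 = ∅ := by
      ext x; simp
    have e₂ : (Finset.Ici (Fin.last N)).erase (Fin.last N) = ∅ := by
      ext x
      simp only [Finset.mem_erase, Finset.mem_Ici, Finset.notMem_empty, iff_false, not_and]
      exact fun h h' => h (le_antisymm (Fin.le_last x) h')
    rw [e₁, e₂, hl, hr, zero_add, add_zero]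
    refine Finset.sum_congr rfl fun i _ => ?_
    have e₃ : (Finset.Iic i.succ).erase i.succ = Finset.Iic i.castSucc := by
      ext x
      simp only [Finset.mem_erase, Finset.mem_Iic, Fin.le_def, ne_eq, Fin.ext_iff, Fin.val_succ,
        Fin.val_castSucc]
      omega
    have e₄ : (Finset.Ici i.castSucc).erase i.castSucc = Finset.Ici i.succ := by
      ext x
      simp only [Finset.mem_erase, Finset.mem_Ici, Fin.le_def, ne_eq, Fin.ext_iff, Fin.val_succ,
        Fin.val_castSucc]
      omega
    rw [e₃, e₄, hK]
  have h₃ : ∀ m, ∑ x ∈ Finset.univ.erase m, K m ((Finset.univ.erase x).filter (· ≤ m))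
        ((Finset.univ.erase x).filter (m ≤ ·)) =
      ∑ x ∈ Finset.Iio m, K m ((Finset.Iic m).erase x) (Finset.Ici m) +
        ∑ x ∈ Finset.Ioi m, K m (Finset.Iic m) ((Finset.Ici m).erase x) := by
    intro m
    rw [sum_erase_eq_sum_Iio_add_sum_Ioi]
    refine congrArg₂ (· + ·) (Finset.sum_congr rfl fun x hx => ?_)
      (Finset.sum_congr rfl fun x hx => ?_)
    · rw [Finset.mem_Iio, Fin.lt_def] at hx
      congr 1 <;>
      · ext y
        simp only [Finset.mem_filter, Finset.mem_erase, Finset.mem_univ, and_true, Finset.mem_Iic,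
          Finset.mem_Ici, Fin.le_def, ne_eq, Fin.ext_iff]
        try omega
    · rw [Finset.mem_Ioi, Fin.lt_def] at hx
      congr 1 <;>
      · ext y
        simp only [Finset.mem_filter, Finset.mem_erase, Finset.mem_univ, and_true, Finset.mem_Iic,
          Finset.mem_Ici, Fin.le_def, ne_eq, Fin.ext_iff]
        try omega
  rw [Finset.sum_comm' (t' := Finset.univ) (s' := fun m => Finset.univ.erase m)
    (by intro x y; simp [eq_comm])]
  simp only [h₃, sum_Iic_eq_sum_Iio_add, sum_Ici_eq_sum_Ioi_add, Finset.sum_add_distrib, h₁]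
  linear_combination (norm := abel) -h2 (∑ m, K m (Finset.Iic m) ((Finset.Ici m).erase m))

/-- The simplicial Leibniz rule for an operation given by cutting out of a simplex the vertices
between two vertices `c < d`. The terms in which `c` or `d` is omitted cancel in pairs, except at
the ends of the ranges of `c` and of `d`; this gives the last two sums. -/
theorem sum_erase_interval (h2 : ∀ x : M, x + x = 0)
    (K : Finset (Fin (N + 1)) → Finset (Fin (N + 1)) → M) :
    ∑ x, ∑ c ∈ Finset.univ.erase x, ∑ d ∈ Finset.univ.erase x with c < d,
        K ((Finset.univ.erase x).filter fun y => c ≤ y ∧ y ≤ d)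
          ((Finset.univ.erase x).filter fun y => ¬ (c < y ∧ y < d)) =
      ∑ c, ∑ d ∈ Finset.Ioi c, (∑ x ∈ Finset.Icc c d,
          K ((Finset.Icc c d).erase x) (Finset.univ \ Finset.Ioo c d) +
        ∑ x ∈ Finset.univ \ Finset.Ioo c d,
          K (Finset.Icc c d) ((Finset.univ \ Finset.Ioo c d).erase x)) +
      ∑ m, K (Finset.Iic m) (Finset.Ici m) + ∑ m, K (Finset.Ici m) (Finset.Iic m) := by
  -- the terms in which `c` is omitted
  have hZ : ∑ c, ∑ d ∈ Finset.Ioi c, (K (Finset.Ioc c d) (Finset.univ \ Finset.Ioo c d) +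
      K (Finset.Icc c d) (Finset.univ \ Finset.Ico c d)) =
      ∑ d, K {d} Finset.univ + ∑ d, K (Finset.Iic d) (Finset.Ici d) := by
    rw [Finset.sum_comm' (t' := Finset.univ) (s' := fun d => Finset.Iio d) (by simp),
      ← Finset.sum_add_distrib]
    refine Finset.sum_congr rfl fun d _ => ?_
    rw [sum_Iio_telescope h2 (fun c => K (Finset.Icc c d) (Finset.univ \ Finset.Ico c d))
      (fun c => K (Finset.Ioc c d) (Finset.univ \ Finset.Ioo c d))]
    · have : Finset.univ \ Finset.Ico 0 d = Finset.Ici d := by ext x; simp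
      have h' : Finset.Icc 0 d = Finset.Iic d := by ext x; simp
      simp [this, h']
    · intro i
      congr 1
      ext y
      simp only [Finset.mem_Ioc, Finset.mem_Icc, Fin.le_def, Fin.lt_def, Fin.val_succ,
        Fin.val_castSucc]
      omega
  -- the terms in which `d` is omitted
  have hY : ∑ c, ∑ d ∈ Finset.Ioi c, (K (Finset.Ico c d) (Finset.univ \ Finset.Ioo c d) +
      K (Finset.Icc c d) (Finset.univ \ Finset.Ioc c d)) =
      ∑ c, K {c} Finset.univ + ∑ c, K (Finset.Ici c) (Finset.Iic c) := by
    rw [← Finset.sum_add_distrib]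
    refine Finset.sum_congr rfl fun c _ => ?_
    rw [sum_Ioi_telescope h2 (fun d => K (Finset.Icc c d) (Finset.univ \ Finset.Ioc c d))
      (fun d => K (Finset.Ico c d) (Finset.univ \ Finset.Ioo c d))]
    · have : Finset.univ \ Finset.Ioc c (Fin.last N) = Finset.Iic c := by
        ext x; simp [Fin.le_last]
      have h' : Finset.Icc c (Fin.last N) = Finset.Ici c := by ext x; simp [Fin.le_last]
      simp [this, h']
    · intro i
      congr 1
      ext y
      simp only [Finset.mem_sdiff, Finset.mem_univ, true_and, Finset.mem_Ioo, Finset.mem_Ioc,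
        Fin.le_def, Fin.lt_def, Fin.val_succ, Fin.val_castSucc]
      omega
  have hterm : ∀ c d : Fin (N + 1), c < d → ∑ x ∈ (Finset.univ.erase c).erase d,
      K ((Finset.univ.erase x).filter fun y => c ≤ y ∧ y ≤ d)
          ((Finset.univ.erase x).filter fun y => ¬ (c < y ∧ y < d)) +
      ((K (Finset.Ioc c d) (Finset.univ \ Finset.Ioo c d) +
        K (Finset.Icc c d) (Finset.univ \ Finset.Ico c d)) +
      (K (Finset.Ico c d) (Finset.univ \ Finset.Ioo c d) +
        K (Finset.Icc c d) (Finset.univ \ Finset.Ioc c d))) =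
      ∑ x ∈ Finset.Icc c d, K ((Finset.Icc c d).erase x) (Finset.univ \ Finset.Ioo c d) +
        ∑ x ∈ Finset.univ \ Finset.Ioo c d,
          K (Finset.Icc c d) ((Finset.univ \ Finset.Ioo c d).erase x) := by
    intro c d hcd
    have e₁ : (Finset.univ.erase c).erase d = Finset.Ioo c d ∪ (Finset.univ \ Finset.Icc c d) := by
      ext y
      have := Fin.lt_def.mp hcd
      simp only [Finset.mem_erase, Finset.mem_union, Finset.mem_sdiff, Finset.mem_univ, true_and,
        and_true, Finset.mem_Ioo, Finset.mem_Icc, Fin.le_def, Fin.lt_def, ne_eq, Fin.ext_iff]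
      omega
    have e₂ : Finset.Icc c d = insert c (insert d (Finset.Ioo c d)) := by
      ext y
      have := Fin.lt_def.mp hcd
      simp only [Finset.mem_insert, Finset.mem_Ioo, Finset.mem_Icc, Fin.le_def, Fin.lt_def,
        Fin.ext_iff]
      omega
    have e₃ : Finset.univ \ Finset.Ioo c d =
        insert c (insert d (Finset.univ \ Finset.Icc c d)) := by
      ext y
      have := Fin.lt_def.mp hcd
      simp only [Finset.mem_insert, Finset.mem_sdiff, Finset.mem_univ, true_and, Finset.mem_Ioo,
        Finset.mem_Icc, Fin.le_def, Fin.lt_def, Fin.ext_iff]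
      omega
    have hd : Disjoint (Finset.Ioo c d) (Finset.univ \ Finset.Icc c d) := by
      rw [Finset.disjoint_left]
      intro y hy hy'
      exact (Finset.mem_sdiff.mp hy').2 (Finset.Ioo_subset_Icc_self hy)
    have s₂ : ∀ f : Fin (N + 1) → M, ∑ x ∈ Finset.Icc c d, f x =
        f c + (f d + ∑ x ∈ Finset.Ioo c d, f x) := fun f => by
      rw [e₂, Finset.sum_insert (by simp [hcd.ne]), Finset.sum_insert (by simp)]
    have s₃ : ∀ f : Fin (N + 1) → M, ∑ x ∈ Finset.univ \ Finset.Ioo c d, f x =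
        f c + (f d + ∑ x ∈ Finset.univ \ Finset.Icc c d, f x) := fun f => by
      rw [e₃, Finset.sum_insert (by simp [hcd.ne, hcd.le]), Finset.sum_insert (by simp [hcd.le])]
    have e₄ : Finset.Ioc c d = (Finset.Icc c d).erase c := (Finset.Icc_erase_left c d).symm
    have e₅ : Finset.Ico c d = (Finset.Icc c d).erase d := (Finset.Icc_erase_right c d).symm
    have e₆ : (Finset.univ \ Finset.Ioo c d).erase c = Finset.univ \ Finset.Ico c d := by
      ext y
      have := Fin.lt_def.mp hcd
      simp only [Finset.mem_erase, Finset.mem_sdiff, Finset.mem_univ, true_and, Finset.mem_Ioo,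
        Finset.mem_Ico, Fin.le_def, Fin.lt_def, ne_eq, Fin.ext_iff]
      omega
    have e₇ : (Finset.univ \ Finset.Ioo c d).erase d = Finset.univ \ Finset.Ioc c d := by
      ext y
      have := Fin.lt_def.mp hcd
      simp only [Finset.mem_erase, Finset.mem_sdiff, Finset.mem_univ, true_and, Finset.mem_Ioo,
        Finset.mem_Ioc, Fin.le_def, Fin.lt_def, ne_eq, Fin.ext_iff]
      omega
    rw [e₁, Finset.sum_union hd, s₂, s₃, e₆, e₇, Finset.Icc_erase_left, Finset.Icc_erase_right]
    have t₁ : ∑ x ∈ Finset.Ioo c d, K ((Finset.univ.erase x).filter fun y => c ≤ y ∧ y ≤ d)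
          ((Finset.univ.erase x).filter fun y => ¬ (c < y ∧ y < d)) =
        ∑ x ∈ Finset.Ioo c d, K ((Finset.Icc c d).erase x) (Finset.univ \ Finset.Ioo c d) := by
      refine Finset.sum_congr rfl fun x hx => ?_
      rw [Finset.mem_Ioo, Fin.lt_def, Fin.lt_def] at hx
      congr 1 <;> ext y <;>
        simp only [Finset.mem_filter, Finset.mem_erase, Finset.mem_sdiff, Finset.mem_univ,
          true_and, and_true, Finset.mem_Ioo, Finset.mem_Icc, Fin.le_def, Fin.lt_def, ne_eq,
          Fin.ext_iff] <;> omega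
    have t₂ : ∑ x ∈ Finset.univ \ Finset.Icc c d,
          K ((Finset.univ.erase x).filter fun y => c ≤ y ∧ y ≤ d)
            ((Finset.univ.erase x).filter fun y => ¬ (c < y ∧ y < d)) =
        ∑ x ∈ Finset.univ \ Finset.Icc c d,
          K (Finset.Icc c d) ((Finset.univ \ Finset.Ioo c d).erase x) := by
      refine Finset.sum_congr rfl fun x hx => ?_
      simp only [Finset.mem_sdiff, Finset.mem_univ, true_and, Finset.mem_Icc, Fin.le_def] at hx
      congr 1 <;> ext y <;>
        simp only [Finset.mem_filter, Finset.mem_erase, Finset.mem_sdiff, Finset.mem_univ,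
          true_and, and_true, Finset.mem_Ioo, Finset.mem_Icc, Fin.le_def, Fin.lt_def, ne_eq,
          Fin.ext_iff] <;> omega
    rw [t₁, t₂]
    abel
  have hswap : ∑ x, ∑ c ∈ Finset.univ.erase x, ∑ d ∈ Finset.univ.erase x with c < d,
        K ((Finset.univ.erase x).filter fun y => c ≤ y ∧ y ≤ d)
          ((Finset.univ.erase x).filter fun y => ¬ (c < y ∧ y < d)) =
      ∑ c, ∑ d ∈ Finset.Ioi c, ∑ x ∈ (Finset.univ.erase c).erase d,
        K ((Finset.univ.erase x).filter fun y => c ≤ y ∧ y ≤ d)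
          ((Finset.univ.erase x).filter fun y => ¬ (c < y ∧ y < d)) := by
    rw [Finset.sum_comm' (t' := Finset.univ) (s' := fun c => Finset.univ.erase c)
      (by intro x y; simp [eq_comm])]
    refine Finset.sum_congr rfl fun c _ => ?_
    exact Finset.sum_comm' (by
      intro x y
      simp only [Finset.mem_erase, Finset.mem_filter, Finset.mem_univ, and_true, Finset.mem_Ioi,
        ne_comm (a := y)]
      tauto)
  rw [hswap]
  have hsum := Finset.sum_congr (s₁ := Finset.univ) rfl fun c _ =>
    Finset.sum_congr (s₁ := Finset.Ioi c) rfl fun d hd => hterm c d (Finset.mem_Ioi.mp hd)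
  simp only [Finset.sum_add_distrib] at hsum hZ hY ⊢
  linear_combination (norm := abel) hsum - hZ - hY - h2 (∑ m, K {m} Finset.univ) -
    h2 (∑ m, K (Finset.Iic m) (Finset.Ici m)) - h2 (∑ m, K (Finset.Ici m) (Finset.Iic m))

end Simplex

/-! ### The Leibniz rules -/

section Leibniz

variable {𝕜 : Type u} [Field 𝕜] [CharP 𝕜 2] {C : Type v₁} [Category.{v₂} C]
  {𝒜 : C ⥤ NonUnitalAlgCat.{u, w} 𝕜}
variable (F G : BiCochain 𝒜)

/-- The defect consists of `f ⌣ g` and of the products of the transported `g` with `f`, summed over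
the vertex `m` at which the simplex is cut. -/
theorem faceVal_delta_circTotal {N : ℕ} (φ : Nerve C N)
    (l : List (𝒜.obj (φ.vertex (Fin.last N)))) :
    faceVal (delta 𝒜 (circTotal F G)) φ Finset.univ 0 (Fin.last N) l =
      faceVal (circTotal (delta 𝒜 F) G) φ Finset.univ 0 (Fin.last N) l +
      faceVal (circTotal F (delta 𝒜 G)) φ Finset.univ 0 (Fin.last N) l +
      faceVal (cup F G) φ Finset.univ 0 (Fin.last N) l +
      ∑ m, splitSum (fun u v => faceVal G φ (Finset.Ici m) 0 (Fin.last N) u *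
        faceVal F φ (Finset.Iic m) 0 (Fin.last N) v) l := by
  have h2 : ∀ x : 𝒜.obj (φ.vertex 0), x + x = 0 := add_self_eq_zero_of_charTwo 𝕜
  -- the simplicial part
  have hS := sum_erase_cut h2 (fun m S T => insertSum (transport 𝒜 φ (Fin.le_last m))
    (faceVal G φ T m (Fin.last N)) (faceVal F φ S 0 m) l)
    (fun m T => by
      rw [show faceVal F φ ∅ 0 m = fun _ => 0 from funext fun z => faceVal_empty F φ 0 m z,
        insertSum_zero])
    (fun m S => by
      rw [show faceVal G φ ∅ m (Fin.last N) = fun _ => 0 from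
        funext fun z => faceVal_empty G φ m _ z,
        insertSum_zero_inner _ (letterAdditive_faceVal F φ S 0 m)])
    (fun i => by
      have hi : i.castSucc ≤ i.succ := Fin.castSucc_le_succ i
      have hF : faceVal F φ (Finset.Iic i.castSucc) 0 i.succ = fun z =>
          faceVal F φ (Finset.Iic i.castSucc) 0 i.castSucc (z.map (transport 𝒜 φ hi)) :=
        funext fun z => (faceVal_map_transport F φ hi (fun x hx => Finset.mem_Iic.mp hx) 0 z).symm
      have hG : faceVal G φ (Finset.Ici i.succ) i.castSucc (Fin.last N) = fun z =>
          transport 𝒜 φ hi (faceVal G φ (Finset.Ici i.succ) i.succ (Fin.last N) z) :=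
        funext fun z => (transport_faceVal G φ hi (fun x hx => Finset.mem_Ici.mp hx) _ z).symm
      rw [hF, hG, insertSum_comp_map]
      simp only [transport_trans])
  -- the Hochschild part
  have hH : ∀ m, wordDelta (transport 𝒜 φ (Fin.zero_le (Fin.last N)))
      (insertSum (transport 𝒜 φ (Fin.le_last m)) (faceVal G φ (Finset.Ici m) m (Fin.last N))
        (faceVal F φ (Finset.Iic m) 0 m)) l =
      insertSum (transport 𝒜 φ (Fin.le_last m)) (faceVal G φ (Finset.Ici m) m (Fin.last N))
        (wordDelta (transport 𝒜 φ (Fin.zero_le m)) (faceVal F φ (Finset.Iic m) 0 m)) l +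
      insertSum (transport 𝒜 φ (Fin.le_last m)) (wordDelta (transport 𝒜 φ (Fin.le_last m))
        (faceVal G φ (Finset.Ici m) m (Fin.last N))) (faceVal F φ (Finset.Iic m) 0 m) l +
      splitSum (fun u v => faceVal F φ (Finset.Iic m) 0 (Fin.last N) u *
        faceVal G φ (Finset.Ici m) 0 (Fin.last N) v) l +
      splitSum (fun u v => faceVal G φ (Finset.Ici m) 0 (Fin.last N) u *
        faceVal F φ (Finset.Iic m) 0 (Fin.last N) v) l := by
    intro m
    have h := wordDelta_insertSum h2 (transport 𝒜 φ (Fin.le_last m))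
      (transport_mul φ (Fin.le_last m)) (transport 𝒜 φ (Fin.zero_le m))
      (faceVal G φ (Finset.Ici m) m (Fin.last N)) (letterAdditive_faceVal F φ (Finset.Iic m) 0 m) l
    simp only [transport_trans, faceVal_map_transport F φ (Fin.le_last m)
      (fun x (hx : x ∈ Finset.Iic m) => Finset.mem_Iic.mp hx),
      transport_faceVal G φ (Fin.zero_le m)
      (fun x (hx : x ∈ Finset.Ici m) => Finset.mem_Ici.mp hx)] at h
    exact h
  have hF : ∀ m, faceVal (delta 𝒜 F) φ (Finset.Iic m) 0 m = fun z =>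
      ∑ x ∈ Finset.Iic m, faceVal F φ ((Finset.Iic m).erase x) 0 m z +
        wordDelta (transport 𝒜 φ (Fin.zero_le m)) (faceVal F φ (Finset.Iic m) 0 m) z :=
    fun m => funext fun z => faceVal_delta F φ (Fin.zero_le m)
      (fun x hx => ⟨Fin.zero_le x, Finset.mem_Iic.mp hx⟩) z
  have hG : ∀ m, faceVal (delta 𝒜 G) φ (Finset.Ici m) m (Fin.last N) = fun z =>
      ∑ x ∈ Finset.Ici m, faceVal G φ ((Finset.Ici m).erase x) m (Fin.last N) z +
        wordDelta (transport 𝒜 φ (Fin.le_last m)) (faceVal G φ (Finset.Ici m) m (Fin.last N)) z :=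
    fun m => funext fun z => faceVal_delta G φ (Fin.le_last m)
      (fun x hx => ⟨Finset.mem_Ici.mp hx, Fin.le_last x⟩) z
  rw [faceVal_delta_univ, show faceVal (circTotal F G) φ Finset.univ 0 (Fin.last N) = _ from
    funext (faceVal_circTotal_univ F G φ), wordDelta_sum, faceVal_circTotal_univ,
    faceVal_circTotal_univ, faceVal_cup_univ]
  simp only [faceVal_circTotal, hS, hF, hG, hH, insertSum_add, insertSum_sum,
    insertSum_add_inner _ _ _ (letterAdditive_faceVal F φ _ _ _),
    insertSum_sum_inner _ _ _ (letterAdditive_faceVal F φ _ _ _), Finset.sum_add_distrib]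
  abel

theorem faceVal_delta_cup {N : ℕ} (φ : Nerve C N)
    (l : List (𝒜.obj (φ.vertex (Fin.last N)))) :
    faceVal (delta 𝒜 (cup F G)) φ Finset.univ 0 (Fin.last N) l =
      faceVal (cup (delta 𝒜 F) G) φ Finset.univ 0 (Fin.last N) l +
      faceVal (cup F (delta 𝒜 G)) φ Finset.univ 0 (Fin.last N) l := by
  have h2 : ∀ x : 𝒜.obj (φ.vertex 0), x + x = 0 := add_self_eq_zero_of_charTwo 𝕜
  have hS := sum_erase_cut h2 (fun _ S T => splitSum (fun u v => faceVal F φ S 0 (Fin.last N) u *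
    faceVal G φ T 0 (Fin.last N) v) l)
    (fun m T => by simp only [faceVal_empty, zero_mul, splitSum_zero])
    (fun m S => by simp only [faceVal_empty, mul_zero, splitSum_zero])
    (fun i => rfl)
  have hd : ∀ (F : BiCochain 𝒜) (S : Finset (Fin (N + 1))),
      faceVal (delta 𝒜 F) φ S 0 (Fin.last N) = fun z =>
      ∑ x ∈ S, faceVal F φ (S.erase x) 0 (Fin.last N) z +
        wordDelta (transport 𝒜 φ (Fin.zero_le _)) (faceVal F φ S 0 (Fin.last N)) z :=
    fun F S => funext fun z => faceVal_delta F φ (Fin.zero_le _)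
      (fun x hx => ⟨Fin.zero_le x, Fin.le_last x⟩) z
  rw [faceVal_delta_univ, show faceVal (cup F G) φ Finset.univ 0 (Fin.last N) = _ from
    funext (faceVal_cup_univ F G φ), wordDelta_sum, faceVal_cup_univ, faceVal_cup_univ]
  simp only [faceVal_cup, hS, hd, wordDelta_cup h2, add_mul, mul_add, Finset.sum_mul,
    Finset.mul_sum, splitSum_add, splitSum_sum, Finset.sum_add_distrib]
  abel

/-- The defect consists of `g ⌣ f` and of the same products of the transported `g` with `f` as for
the operation `∘`. -/
theorem faceVal_delta_bulletTotal {N : ℕ} (φ : Nerve C N)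
    (l : List (𝒜.obj (φ.vertex (Fin.last N)))) :
    faceVal (delta 𝒜 (bulletTotal F G)) φ Finset.univ 0 (Fin.last N) l =
      faceVal (bulletTotal (delta 𝒜 F) G) φ Finset.univ 0 (Fin.last N) l +
      faceVal (bulletTotal F (delta 𝒜 G)) φ Finset.univ 0 (Fin.last N) l +
      faceVal (cup G F) φ Finset.univ 0 (Fin.last N) l +
      ∑ m, splitSum (fun u v => faceVal G φ (Finset.Ici m) 0 (Fin.last N) u *
        faceVal F φ (Finset.Iic m) 0 (Fin.last N) v) l := by
  have h2 : ∀ x : 𝒜.obj (φ.vertex 0), x + x = 0 := add_self_eq_zero_of_charTwo 𝕜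
  have hS := sum_erase_interval h2 (fun S T => splitSum
    (fun u v => faceVal G φ S 0 (Fin.last N) u * faceVal F φ T 0 (Fin.last N) v) l)
  have hd : ∀ (F : BiCochain 𝒜) (S : Finset (Fin (N + 1))),
      faceVal (delta 𝒜 F) φ S 0 (Fin.last N) = fun z =>
      ∑ x ∈ S, faceVal F φ (S.erase x) 0 (Fin.last N) z +
        wordDelta (transport 𝒜 φ (Fin.zero_le _)) (faceVal F φ S 0 (Fin.last N)) z :=
    fun F S => funext fun z => faceVal_delta F φ (Fin.zero_le _)
      (fun x hx => ⟨Fin.zero_le x, Fin.le_last x⟩) z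
  rw [faceVal_delta_univ, show faceVal (bulletTotal F G) φ Finset.univ 0 (Fin.last N) = _ from
    funext (faceVal_bulletTotal_univ F G φ), wordDelta_sum, faceVal_bulletTotal_univ,
    faceVal_bulletTotal_univ, faceVal_cup_univ]
  simp only [faceVal_bulletTotal, hS, hd, wordDelta_sum, wordDelta_cup h2, add_mul, mul_add,
    Finset.sum_mul, Finset.mul_sum, splitSum_add, splitSum_sum, Finset.sum_add_distrib]
  abel

end Leibniz

/-! ### The squaring map -/

section Squaring

variable {𝕜 : Type u} [Field 𝕜] {C : Type v₁} [Category.{v₂} C]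
  {𝒜 : C ⥤ NonUnitalAlgCat.{u, w} 𝕜}

theorem act_zero {p p' q : ℕ} (ζ : Fin (p + 1) →o Fin (p' + 1)) :
    act ζ (0 : Cochain 𝒜 p q) = 0 := by
  simpa using act_smul ζ (0 : 𝕜) (0 : Cochain 𝒜 p q)

theorem circ_zero_left {p₁ q₁ p₂ q₂ p q : ℕ} (hp : p₁ + p₂ = p) (hq : q₁ + q₂ = q + 1)
    (g : Cochain 𝒜 p₂ q₂) : circ hp hq (0 : Cochain 𝒜 p₁ q₁) g = 0 := by
  simpa using circ_smul_left hp hq (0 : 𝕜) 0 g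

theorem circ_zero_right {p₁ q₁ p₂ q₂ p q : ℕ} (hp : p₁ + p₂ = p) (hq : q₁ + q₂ = q + 1)
    (f : Cochain 𝒜 p₁ q₁) : circ hp hq f (0 : Cochain 𝒜 p₂ q₂) = 0 := by
  simpa using circ_smul_right hp hq (0 : 𝕜) f 0

theorem mulMap_zero_left {A : NonUnitalAlgCat.{u, w} 𝕜} {U : Type w} [AddCommGroup U] [Module 𝕜 U]
    {q₁ q₂ q : ℕ} (hq : q₁ + q₂ = q) (F : MultilinearMap 𝕜 (fun _ : Fin q₁ => U) A) :
    mulMap hq (0 : MultilinearMap 𝕜 (fun _ : Fin q₂ => U) A) F = 0 := by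
  ext a
  exact zero_mul _

theorem mulMap_zero_right {A : NonUnitalAlgCat.{u, w} 𝕜} {U : Type w} [AddCommGroup U]
    [Module 𝕜 U] {q₁ q₂ q : ℕ} (hq : q₁ + q₂ = q)
    (G : MultilinearMap 𝕜 (fun _ : Fin q₂ => U) A) :
    mulMap hq G (0 : MultilinearMap 𝕜 (fun _ : Fin q₁ => U) A) = 0 := by
  ext a
  exact mul_zero _

theorem bullet_zero_left {p₁ q₁ p₂ q₂ p q : ℕ} (hp : p₁ + p₂ = p + 1) (hq : q₁ + q₂ = q)
    (g : Cochain 𝒜 p₂ q₂) : bullet hp hq (0 : Cochain 𝒜 p₁ q₁) g = 0 := by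
  funext φ
  simp only [bullet, act_zero, Pi.zero_apply, mulMap_zero_right, smul_zero,
    Finset.sum_const_zero, dite_eq_ite, ite_self]

theorem bullet_zero_right {p₁ q₁ p₂ q₂ p q : ℕ} (hp : p₁ + p₂ = p + 1) (hq : q₁ + q₂ = q)
    (f : Cochain 𝒜 p₁ q₁) : bullet hp hq f (0 : Cochain 𝒜 p₂ q₂) = 0 := by
  funext φ
  simp only [bullet, act_zero, Pi.zero_apply, mulMap_zero_left, smul_zero,
    Finset.sum_const_zero, dite_eq_ite, ite_self]

theorem compBar_mem_tot {f g : BiCochain 𝒜} {a b n : ℤ} (hf : f ∈ tot 𝒜 a) (hg : g ∈ tot 𝒜 b)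
    (hn : a + b = n + 1) : compBar f g ∈ tot 𝒜 n := by
  intro p q hpq
  have key : ∀ p₁ p₂ q₁ q₂ : ℕ, p₁ + p₂ + (q₁ + q₂) = p + q + 1 → f p₁ q₁ = 0 ∨ g p₂ q₂ = 0 := by
    intro p₁ p₂ q₁ q₂ h
    by_cases h₁ : (p₁ : ℤ) + q₁ = a
    · exact Or.inr (hg p₂ q₂ (by omega))
    · exact Or.inl (hf p₁ q₁ h₁)
  unfold compBar
  rw [Finset.sum_eq_zero, Finset.sum_eq_zero, add_zero]
  · intro x _
    refine Finset.sum_eq_zero fun y _ => ?_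
    have hx := Finset.HasAntidiagonal.mem_antidiagonal.mp x.2
    have hy := Finset.HasAntidiagonal.mem_antidiagonal.mp y.2
    rcases key x.1.1 x.1.2 y.1.1 y.1.2 (by omega) with h | h
    · rw [h, bullet_zero_left]
    · rw [h, bullet_zero_right]
  · intro x _
    refine Finset.sum_eq_zero fun y _ => ?_
    have hx := Finset.HasAntidiagonal.mem_antidiagonal.mp x.2
    have hy := Finset.HasAntidiagonal.mem_antidiagonal.mp y.2
    rcases key x.1.1 x.1.2 y.1.1 y.1.2 (by omega) with h | h
    · rw [h, circ_zero_left]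
    · rw [h, circ_zero_right]

theorem cup_mem_tot {f g : BiCochain 𝒜} {a b n : ℤ} (hf : f ∈ tot 𝒜 a) (hg : g ∈ tot 𝒜 b)
    (hn : a + b = n) : cup f g ∈ tot 𝒜 n := by
  intro p q hpq
  funext φ
  refine Finset.sum_eq_zero fun x _ => Finset.sum_eq_zero fun y _ => ?_
  have hx := Finset.HasAntidiagonal.mem_antidiagonal.mp x.2
  have hy := Finset.HasAntidiagonal.mem_antidiagonal.mp y.2
  by_cases h₁ : (x.1.1 : ℤ) + y.1.1 = a
  · rw [hg x.1.2 y.1.2 (by omega), act_zero, Pi.zero_apply, mulMap_zero_right]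
  · rw [hf x.1.1 y.1.1 h₁, act_zero, Pi.zero_apply, mulMap_zero_left]

variable [CharP 𝕜 2]

theorem compBar_add_left (f f' g : BiCochain 𝒜) :
    compBar (f + f') g = compBar f g + compBar f' g := by
  refine biCochain_ext fun N φ l => ?_
  have h : ∀ S s e, faceVal (f + f') φ S s e =
      fun z => faceVal f φ S s e z + faceVal f' φ S s e z :=
    fun S s e => funext fun z => faceVal_add f f' φ S s e z
  simp only [compBar_eq, faceVal_add, faceVal_circTotal_univ, faceVal_bulletTotal_univ, h,
    insertSum_add, mul_add, splitSum_add, Finset.sum_add_distrib]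
  abel

theorem compBar_add_right (f g g' : BiCochain 𝒜) :
    compBar f (g + g') = compBar f g + compBar f g' := by
  refine biCochain_ext fun N φ l => ?_
  have h : ∀ S s e, faceVal (g + g') φ S s e =
      fun z => faceVal g φ S s e z + faceVal g' φ S s e z :=
    fun S s e => funext fun z => faceVal_add g g' φ S s e z
  simp only [compBar_eq, faceVal_add, faceVal_circTotal_univ, faceVal_bulletTotal_univ, h,
    insertSum_add_inner _ _ _ (letterAdditive_faceVal f φ _ _ _), add_mul, splitSum_add,
    Finset.sum_add_distrib]
  abel

theorem compBar_zero_left (g : BiCochain 𝒜) : compBar 0 g = 0 := by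
  simpa using compBar_add_left 0 0 g

theorem compBar_zero_right (f : BiCochain 𝒜) : compBar f 0 = 0 := by
  simpa using compBar_add_right f 0 0

/-- The coboundary of `f ∘̄ g`. The products in which `g` on the end of a simplex precedes `f` on
its beginning come from both parts of `f ∘̄ g` and cancel. -/
theorem delta_compBar (f g : BiCochain 𝒜) :
    delta 𝒜 (compBar f g) =
      compBar (delta 𝒜 f) g + compBar f (delta 𝒜 g) + cup f g + cup g f := by
  refine biCochain_ext fun N φ l => ?_
  rw [compBar_eq, compBar_eq, compBar_eq, map_add]
  simp only [faceVal_add, faceVal_delta_circTotal, faceVal_delta_bulletTotal]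
  linear_combination (norm := abel) add_self_eq_zero_of_charTwo 𝕜
    (∑ m, splitSum (fun u v => faceVal g φ (Finset.Ici m) 0 (Fin.last N) u *
        faceVal f φ (Finset.Iic m) 0 (Fin.last N) v) l)

theorem delta_cup (f g : BiCochain 𝒜) :
    delta 𝒜 (cup f g) = cup (delta 𝒜 f) g + cup f (delta 𝒜 g) := by
  refine biCochain_ext fun N φ l => ?_
  rw [faceVal_add, faceVal_delta_cup]

theorem Sq_mem_cocycles {k : ℤ} {f : BiCochain 𝒜} (hf : f ∈ cocycles 𝒜 k) :
    Sq f ∈ cocycles 𝒜 (2 * k - 1) := by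
  refine ⟨compBar_mem_tot hf.1 hf.1 (by ring), ?_⟩
  have hf' : delta 𝒜 f = 0 := hf.2
  change delta 𝒜 (compBar f f) = 0
  rw [delta_compBar, hf', compBar_zero_left, compBar_zero_right, add_zero,
    zero_add, add_self_eq_zero_of_charTwo 𝕜]

/-- Cohomologous cocycles have cohomologous squares: if `f = f' + δh`, then `Sq f - Sq f'` is the
coboundary of `f' ∘̄ h + h ∘̄ f' + h ∘̄ δh + h ⌣ h`. -/
theorem Sq_sub_Sq_mem_coboundaries {k : ℤ} {f f' : BiCochain 𝒜} (hf : f ∈ cocycles 𝒜 k)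
    (hf' : f' ∈ cocycles 𝒜 k) (h : f - f' ∈ coboundaries 𝒜 k) :
    Sq f - Sq f' ∈ coboundaries 𝒜 (2 * k - 1) := by
  obtain ⟨h, hh, hd⟩ := h
  have hδ : delta 𝒜 h ∈ tot 𝒜 k := hd ▸ (tot 𝒜 k).sub_mem hf.1 hf'.1
  have hδf : delta 𝒜 f' = 0 := hf'.2
  have hδδ : delta 𝒜 (delta 𝒜 h) = 0 := by
    rw [hd, map_sub, hδf, show delta 𝒜 f = 0 from hf.2, sub_zero]
  obtain rfl : f = f' + delta 𝒜 h := by rw [hd]; abel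
  have h2 : ∀ x : BiCochain 𝒜, x + x = 0 := add_self_eq_zero_of_charTwo 𝕜
  refine ⟨compBar f' h + compBar h f' + compBar h (delta 𝒜 h) + cup h h,
    (tot 𝒜 _).add_mem ((tot 𝒜 _).add_mem ((tot 𝒜 _).add_mem
      (compBar_mem_tot hf'.1 hh (by ring)) (compBar_mem_tot hh hf'.1 (by ring)))
      (compBar_mem_tot hh hδ (by ring))) (cup_mem_tot hh hh (by ring)), ?_⟩
  simp only [map_add, delta_compBar, delta_cup, hδf, hδδ, compBar_zero_left, compBar_zero_right,
    Sq, compBar_add_left, compBar_add_right]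
  linear_combination (norm := abel) h2 (cup f' h) + h2 (cup h f') + h2 (cup h (delta 𝒜 h)) +
    h2 (cup (delta 𝒜 h) h)

end Squaring

end DiagramHochschild

theorem mainTheorem12 {𝕜 : Type u} [Field 𝕜] [CharP 𝕜 2] {C : Type v₁} [Category.{v₂} C]
    (𝒜 : C ⥤ NonUnitalAlgCat.{u, w} 𝕜) (k : ℤ) :
    ∃ hSq : ∀ f ∈ DiagramHochschild.cocycles 𝒜 k,
        DiagramHochschild.Sq f ∈ DiagramHochschild.cocycles 𝒜 (2 * k - 1),
      ∃ sq : DiagramHochschild.HochschildCohomology 𝒜 k →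
          DiagramHochschild.HochschildCohomology 𝒜 (2 * k - 1),
        ∀ (f : DiagramHochschild.BiCochain 𝒜) (hf : f ∈ DiagramHochschild.cocycles 𝒜 k),
          sq (DiagramHochschild.cohomologyClass f hf) =
            DiagramHochschild.cohomologyClass (DiagramHochschild.Sq f) (hSq f hf) := by
  refine ⟨fun f hf => DiagramHochschild.Sq_mem_cocycles hf, fun x => Quotient.liftOn' x
    (fun z => DiagramHochschild.cohomologyClass (DiagramHochschild.Sq z.1)
      (DiagramHochschild.Sq_mem_cocycles z.2)) ?_, fun f hf => rfl⟩
  intro z z' h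
  exact (Submodule.Quotient.eq _).mpr (DiagramHochschild.Sq_sub_Sq_mem_coboundaries z.2 z'.2
    ((Submodule.quotientRel_def ((DiagramHochschild.coboundaries 𝒜 k).submoduleOf
      (DiagramHochschild.cocycles 𝒜 k))).mp h))
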